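/- Let $L$ be a smooth operator field (tensor field of type $(1,1)$) on an open neighbourhood of $0\in\mathbb{R}^3$ that is a Nijenhuis operator, i.e. $L^2[u,v]+[Lu,Lv]-L[Lu,v]-L[u,Lv]=0$ for all smooth vector fields $u,v$, and let $\chi(t)=\det(t\,\mathrm{Id}-L)=t^3+\sigma_1t^2+\sigma_2t+\sigma_3$ be its characteristic polynomial. Suppose that $d\sigma_2$ and $d\sigma_3$ are linearly independent at every point near $0$, that $\sigma_2(0)=\sigma_3(0)=0$, and that the restriction of $\sigma_1$ to the joint level line $\{\sigma_2=0,\ \sigma_3=0\}$ has a Morse singularity (a nondegenerate critical point) at $0$; put $c=\sigma_1(0)$. If $c=0$, no Nijenhuis operator with these properties exists. If $c\neq0$, there exist a choice of sign and a regular (smooth, with smooth inverse) change of coordinates near $0$, preserving the origin, such that in the new coordinates $(x,y,z)$ $$ L=\begin{bmatrix}\mp x^2-c & -\frac{x}{2c} & \frac{x}{2c^2}\\ \mp 2xy & -\frac{y}{c} & \frac{y}{c^2}+1\\ \mp 2xz & -\frac{z}{c} & \frac{z}{c^2}\end{bmatrix}, \qquad \chi(t)=t^3+\Bigl(\pm x^2+\frac{y}{c}-\frac{z}{c^2}+c\Bigr)t^2+yt+z,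 $$ where the upper signs are taken throughout or the lower signs are taken throughout. -/

import Mathlib

open Set Filter Topology
open scoped ContDiff

namespace NijenhuisGeometry

/-- Coordinate space of dimension `n`. -/
abbrev Coord (n : ℕ) : Type := Fin n → ℝ

/-- An operator field (a tensor field of type (1,1)) on (a part of) coordinate space. -/
abbrev OpField (n : ℕ) : Type := Coord n → (Coord n →L[ℝ] Coord n)

/-- The vector field `L u`. -/
def OpField.act {n : ℕ} (L : OpField n) (u : Coord n → Coord n) : Coord n → Coord n :=
  fun x => L x (u x)

/-- The Nijenhuis torsion
`N_L(u,v) = L²[u,v] + [Lu,Lv] - L[Lu,v] - L[u,Lv]` at the point `x`. -/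
noncomputable def nijenhuisTorsion {n : ℕ} (L : OpField n) (u v : Coord n → Coord n)
    (x : Coord n) : Coord n :=
  L x (L x (VectorField.lieBracket ℝ u v x))
    + VectorField.lieBracket ℝ (L.act u) (L.act v) x
    - L x (VectorField.lieBracket ℝ (L.act u) v x)
    - L x (VectorField.lieBracket ℝ u (L.act v) x)

/-- `L` is a (smooth) Nijenhuis operator on the set `U` (to be used for open `U`): it is smooth
on `U` and its torsion vanishes on all pairs of smooth vector fields on `U`. -/
structure IsNijenhuisOn {n : ℕ} (L : OpField n) (U : Set (Coord n)) : Prop where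
  smooth : ContDiffOn ℝ ∞ L U
  torsion_eq_zero : ∀ u v : Coord n → Coord n, ContDiffOn ℝ ∞ u U → ContDiffOn ℝ ∞ v U →
    ∀ x ∈ U, nijenhuisTorsion L u v x = 0

/-- The characteristic polynomial `χ(t) = det (t Id - L)` at the point `x`. -/
noncomputable def charPoly {n : ℕ} (L : OpField n) (x : Coord n) : Polynomial ℝ :=
  (L x : Coord n →ₗ[ℝ] Coord n).charpoly

/-- The invariants `σ_i`, `1 ≤ i ≤ n`, with `χ(t) = t^n + σ_1 t^(n-1) + ... + σ_n`. -/
noncomputable def sigma {n : ℕ} (L : OpField n) (i : ℕ) (x : Coord n) : ℝ :=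
  (charPoly L x).coeff (n - i)

/-- For functions `f, g, h` on three-dimensional space, smooth near `p`, with `dg, dh` linearly
independent at `p`: the restriction of `f` to the joint level line of `g` and `h` through `p` has
a Morse singularity (a nondegenerate critical point) at `p`. The level line is near `p` a smooth
curve, and a smooth curve `γ` in it with `γ 0 = p` and `γ' 0 ≠ 0` is a local parameter of it. -/
def HasMorseSingularityOnLevelLine (f g h : Coord 3 → ℝ) (p : Coord 3) : Prop :=
  ∃ (δ : ℝ) (γ : ℝ → Coord 3), 0 < δ ∧ ContDiffOn ℝ ∞ γ (Ioo (-δ) δ) ∧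
    γ 0 = p ∧ deriv γ 0 ≠ 0 ∧
    (∀ t ∈ Ioo (-δ) δ, g (γ t) = g p ∧ h (γ t) = h p) ∧
    deriv (fun t => f (γ t)) 0 = 0 ∧
    deriv (deriv (fun t => f (γ t))) 0 ≠ 0

/-- `φ` is a regular (smooth, with smooth inverse) change of coordinates. -/
structure IsSmoothChange {n : ℕ} (φ : OpenPartialHomeomorph (Coord n) (Coord n)) : Prop where
  smooth : ContDiffOn ℝ ∞ φ φ.source
  smooth_symm : ContDiffOn ℝ ∞ φ.symm φ.target

/-- The matrix of `L` in the new coordinates `φ`, at the point whose new coordinates are `q`. -/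
noncomputable def matrixInCoords {n : ℕ} (L : OpField n)
    (φ : OpenPartialHomeomorph (Coord n) (Coord n)) (q : Coord n) : Matrix (Fin n) (Fin n) ℝ :=
  LinearMap.toMatrix' (((fderiv ℝ φ (φ.symm q)).comp
    ((L (φ.symm q)).comp (fderiv ℝ φ.symm q)) : Coord n →L[ℝ] Coord n) :
      Coord n →ₗ[ℝ] Coord n)

end NijenhuisGeometry

/-! Write `dσ_i = -tr(A_i dL)` with `A_1 = Id`, `A_2 = L + σ_1`, `A_3 = adj L`. Each `A_i` commutes
with `L`, so contracting the vanishing torsion with `A_i` gives `L* dσ_i = dσ_{i+1} - σ_i dσ_1`,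
with `σ_4 = 0`. Everything after that uses only these three relations and the smoothness of `L`.

Let `u` be the Jacobian of `(σ_1, σ_2, σ_3)`. The Morse condition says that `u` vanishes at `0` and
that `(u, σ_2, σ_3)` are coordinates there (`jacobian_of_morse`). In them `∂σ_1/∂u` is `u` times a
nonvanishing function, so a Morse lemma with parameters gives `σ_1 = ± X² + g(σ_2, σ_3)`
(`exists_square_decomposition`).

On the surface `u = 0` the differential of `σ_1` is `P dσ_2 + Q dσ_3`. Inserting this in the three
relations, with `y = σ_2` and `z = σ_3`, gives `Q = -P²` and the Clairaut equation `g = yP - zP² +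
1/P`. Differentiation yields `(y - 2zP - 1/P²) dP = 0`. The first factor, which would give the
singular solution, is nonzero at the origin, so `P` is constant and `g` is affine. At the origin the
equation reads `cP = 1`; this excludes `c = 0` and gives `P = 1/c` (`eq_affine_of_clairaut`).

In the coordinates `(X, σ_2, σ_3)` the relations determine `L` wherever `X ≠ 0`, hence everywhere by
continuity (`matrixInCoords_eq_normalForm`). -/

namespace NijenhuisGeometry

/-! ### Matrix entries and the coefficients of the characteristic polynomial. -/

/-- The `(i, j)` entry of the matrix of `L`, as a function of the point. -/
def OpField.entry {n : ℕ} (L : OpField n) (i j : Fin n) (p : Coord n) : ℝ :=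
  L p (Pi.single j 1) i

theorem OpField.apply_eq_sum_entry {n : ℕ} (L : OpField n) (p v : Coord n) (i : Fin n) :
    L p v i = ∑ j, v j * L.entry i j p := by
  conv_lhs => rw [pi_eq_sum_univ' v]
  simp [OpField.entry, map_sum, Finset.sum_apply]

theorem charPoly_eq_entries (L : OpField 3) (p : Coord 3) :
    charPoly L p = Polynomial.X ^ 3
      + Polynomial.C (-(L.entry 0 0 p + L.entry 1 1 p + L.entry 2 2 p)) * Polynomial.X ^ 2
      + Polynomial.C (L.entry 0 0 p * L.entry 1 1 p - L.entry 0 1 p * L.entry 1 0 p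
          + (L.entry 0 0 p * L.entry 2 2 p - L.entry 0 2 p * L.entry 2 0 p)
          + (L.entry 1 1 p * L.entry 2 2 p - L.entry 1 2 p * L.entry 2 1 p)) * Polynomial.X
      + Polynomial.C (-(L.entry 0 0 p * (L.entry 1 1 p * L.entry 2 2 p
            - L.entry 1 2 p * L.entry 2 1 p)
          - L.entry 0 1 p * (L.entry 1 0 p * L.entry 2 2 p - L.entry 1 2 p * L.entry 2 0 p)
          + L.entry 0 2 p * (L.entry 1 0 p * L.entry 2 1 p - L.entry 1 1 p * L.entry 2 0 p))) := by
  have h : charPoly L p = (Matrix.of fun i j => L.entry i j p).charpoly := by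
    rw [charPoly, ← LinearMap.charpoly_toMatrix _ (Pi.basisFun ℝ (Fin 3))]
    congr 1
  rw [h, Matrix.charpoly, Matrix.det_fin_three]
  simp only [Matrix.charmatrix_apply, Matrix.diagonal_apply, Matrix.of_apply, map_neg, map_add,
    map_sub, map_mul]
  simp
  ring

theorem charPoly_coeff (a b c : ℝ) :
    let P : Polynomial ℝ := Polynomial.X ^ 3 + Polynomial.C a * Polynomial.X ^ 2
      + Polynomial.C b * Polynomial.X + Polynomial.C c
    P.coeff 2 = a ∧ P.coeff 1 = b ∧ P.coeff 0 = c := by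
  refine ⟨?_, ?_, ?_⟩ <;>
    simp [Polynomial.coeff_X_pow, Polynomial.coeff_X, Polynomial.coeff_C]

theorem sigma_one_eq (L : OpField 3) (p : Coord 3) :
    sigma L 1 p = -(L.entry 0 0 p + L.entry 1 1 p + L.entry 2 2 p) := by
  rw [sigma, charPoly_eq_entries]
  exact (charPoly_coeff _ _ _).1

theorem sigma_two_eq (L : OpField 3) (p : Coord 3) :
    sigma L 2 p = L.entry 0 0 p * L.entry 1 1 p - L.entry 0 1 p * L.entry 1 0 p
          + (L.entry 0 0 p * L.entry 2 2 p - L.entry 0 2 p * L.entry 2 0 p)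
          + (L.entry 1 1 p * L.entry 2 2 p - L.entry 1 2 p * L.entry 2 1 p) := by
  rw [sigma, charPoly_eq_entries]
  exact (charPoly_coeff _ _ _).2.1

theorem sigma_three_eq (L : OpField 3) (p : Coord 3) :
    sigma L 3 p = -(L.entry 0 0 p * (L.entry 1 1 p * L.entry 2 2 p
            - L.entry 1 2 p * L.entry 2 1 p)
          - L.entry 0 1 p * (L.entry 1 0 p * L.entry 2 2 p - L.entry 1 2 p * L.entry 2 0 p)
          + L.entry 0 2 p * (L.entry 1 0 p * L.entry 2 1 p - L.entry 1 1 p * L.entry 2 0 p)) := by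
  rw [sigma, charPoly_eq_entries]
  exact (charPoly_coeff _ _ _).2.2

theorem charPoly_eq_sigma (L : OpField 3) (p : Coord 3) :
    charPoly L p = Polynomial.X ^ 3 + Polynomial.C (sigma L 1 p) * Polynomial.X ^ 2
      + Polynomial.C (sigma L 2 p) * Polynomial.X + Polynomial.C (sigma L 3 p) := by
  rw [sigma_one_eq, sigma_two_eq, sigma_three_eq, charPoly_eq_entries]

section Smooth

variable {U : Set (Coord 3)} {L : OpField 3}

theorem contDiffOn_entry (hL : ContDiffOn ℝ ∞ L U) (i j : Fin 3) :
    ContDiffOn ℝ ∞ (L.entry i j) U := by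
  have h : ContDiffOn ℝ ∞ (fun p => L p (Pi.single j 1)) U := hL.clm_apply contDiffOn_const
  exact contDiffOn_pi.1 h i

theorem contDiffOn_sigma_one (hL : ContDiffOn ℝ ∞ L U) : ContDiffOn ℝ ∞ (sigma L 1) U := by
  have h := contDiffOn_entry hL
  rw [funext (sigma_one_eq L)]
  exact (((h 0 0).add (h 1 1)).add (h 2 2)).neg

theorem contDiffOn_sigma_two (hL : ContDiffOn ℝ ∞ L U) : ContDiffOn ℝ ∞ (sigma L 2) U := by
  have h := contDiffOn_entry hL
  rw [funext (sigma_two_eq L)]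
  exact ((((h 0 0).mul (h 1 1)).sub ((h 0 1).mul (h 1 0))).add
    (((h 0 0).mul (h 2 2)).sub ((h 0 2).mul (h 2 0)))).add
    (((h 1 1).mul (h 2 2)).sub ((h 1 2).mul (h 2 1)))

theorem contDiffOn_sigma_three (hL : ContDiffOn ℝ ∞ L U) : ContDiffOn ℝ ∞ (sigma L 3) U := by
  have h := contDiffOn_entry hL
  rw [funext (sigma_three_eq L)]
  exact ((((h 0 0).mul (((h 1 1).mul (h 2 2)).sub ((h 1 2).mul (h 2 1)))).sub
    ((h 0 1).mul (((h 1 0).mul (h 2 2)).sub ((h 1 2).mul (h 2 0))))).add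
    ((h 0 2).mul (((h 1 0).mul (h 2 1)).sub ((h 1 1).mul (h 2 0))))).neg

end Smooth

/-! ### The torsion in coordinates. -/

theorem entry_hasFDerivAt {L : OpField 3} {p : Coord 3} (hL : DifferentiableAt ℝ L p)
    (i j : Fin 3) : HasFDerivAt (L.entry i j) (fderiv ℝ (L.entry i j) p) p := by
  have h : DifferentiableAt ℝ (fun p => L p (Pi.single j 1)) p :=
    hL.clm_apply (differentiableAt_const _)
  exact (differentiableAt_pi.1 h i).hasFDerivAt

theorem fderiv_entry_apply {L : OpField 3} {p : Coord 3} (hL : DifferentiableAt ℝ L p)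
    (i j : Fin 3) (w : Coord 3) :
    fderiv ℝ (L.entry i j) p w = fderiv ℝ L p w (Pi.single j 1) i := by
  have h : HasFDerivAt (fun p => L p (Pi.single j 1))
      ((fderiv ℝ L p).flip (Pi.single j 1)) p := by
    simpa using hL.hasFDerivAt.clm_apply (hasFDerivAt_const (Pi.single j (1 : ℝ)) p)
  have h2 := (hasFDerivAt_pi'.1 h i).fderiv
  change fderiv ℝ (fun p => L p (Pi.single j 1) i) p w = _
  rw [h2]
  rfl

/-- Vanishing of the Nijenhuis torsion on the coordinate vector fields, in terms of the entries
of the operator. -/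
theorem IsNijenhuisOn.entry_identity {U : Set (Coord 3)} (hU : IsOpen U) {L : OpField 3}
    (hL : IsNijenhuisOn L U) {p : Coord 3} (hp : p ∈ U) (i j k : Fin 3) :
    (∑ l, L.entry l j p * fderiv ℝ (L.entry i k) p (Pi.single l 1))
      - (∑ l, L.entry l k p * fderiv ℝ (L.entry i j) p (Pi.single l 1))
      + (∑ l, fderiv ℝ (L.entry l j) p (Pi.single k 1) * L.entry i l p)
      - (∑ l, fderiv ℝ (L.entry l k) p (Pi.single j 1) * L.entry i l p) = 0 := by
  have hd : DifferentiableAt ℝ L p :=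
    ((hL.smooth p hp).contDiffAt (hU.mem_nhds hp)).differentiableAt (by simp)
  have key : ∀ (j : Fin 3), HasFDerivAt (fun p => L p (Pi.single j 1))
      ((fderiv ℝ L p).flip (Pi.single j 1)) p := fun j => by
    simpa using hd.hasFDerivAt.clm_apply (hasFDerivAt_const (Pi.single j (1 : ℝ)) p)
  -- Constant fields commute, so the term `L²[u,v]` drops out and only first derivatives of `L`
  -- remain.
  have ht := hL.torsion_eq_zero (fun _ => Pi.single j 1) (fun _ => Pi.single k 1)
    contDiffOn_const contDiffOn_const p hp
  have hsum : ∀ (i k : Fin 3) (w : Coord 3),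
      ∑ l, w l * fderiv ℝ (L.entry i k) p (Pi.single l 1) = fderiv ℝ L p w (Pi.single k 1) i := by
    intro i k w
    rw [← fderiv_entry_apply hd]
    conv_rhs => rw [pi_eq_sum_univ' w]
    simp [map_sum]
  unfold nijenhuisTorsion OpField.act VectorField.lieBracket at ht
  simp only [(key _).fderiv, fderiv_fun_const, Pi.zero_apply, _root_.zero_apply,
    sub_zero, zero_sub, map_zero, map_neg, zero_add, ContinuousLinearMap.flip_apply] at ht
  have hti := congrFun ht i
  simp only [Pi.sub_apply, Pi.neg_apply, Pi.zero_apply] at hti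
  have e1 := hsum i k (L p (Pi.single j 1))
  have e2 := hsum i j (L p (Pi.single k 1))
  have e3 := L.apply_eq_sum_entry p (fderiv ℝ L p (Pi.single k 1) (Pi.single j 1)) i
  have e4 := L.apply_eq_sum_entry p (fderiv ℝ L p (Pi.single j 1) (Pi.single k 1)) i
  simp only [fderiv_entry_apply hd] at *
  simp only [OpField.entry] at *
  linarith


/-! ### The relations between the differentials of the `σ_i`. -/

section Differentials

variable {U : Set (Coord 3)} {L : OpField 3} {p : Coord 3}

theorem fderiv_sigma_one_apply (hd : DifferentiableAt ℝ L p) (w : Coord 3) :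
    fderiv ℝ (sigma L 1) p w = -(fderiv ℝ (L.entry 0 0) p w + fderiv ℝ (L.entry 1 1) p w
      + fderiv ℝ (L.entry 2 2) p w) := by
  have h := entry_hasFDerivAt hd
  have h1 := (((h 0 0).add (h 1 1)).add (h 2 2)).neg
  have h2 : HasFDerivAt (sigma L 1) _ p :=
    h1.congr_of_eventuallyEq (Eventually.of_forall fun q => sigma_one_eq L q)
  rw [h2.fderiv]
  simp

/-- This is `-tr((L + σ_1) dL)`, written out so that its coefficients can serve as weights in
contracting the torsion. -/
theorem fderiv_sigma_two_apply (hd : DifferentiableAt ℝ L p) (w : Coord 3) :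
    fderiv ℝ (sigma L 2) p w =
      -((L.entry 0 0 p - (L.entry 0 0 p + L.entry 1 1 p + L.entry 2 2 p)) * fderiv ℝ (L.entry 0 0) p w
        + (L.entry 1 0 p) * fderiv ℝ (L.entry 0 1) p w
        + (L.entry 2 0 p) * fderiv ℝ (L.entry 0 2) p w
        + (L.entry 0 1 p) * fderiv ℝ (L.entry 1 0) p w
        + (L.entry 1 1 p - (L.entry 0 0 p + L.entry 1 1 p + L.entry 2 2 p)) * fderiv ℝ (L.entry 1 1) p w
        + (L.entry 2 1 p) * fderiv ℝ (L.entry 1 2) p w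
        + (L.entry 0 2 p) * fderiv ℝ (L.entry 2 0) p w
        + (L.entry 1 2 p) * fderiv ℝ (L.entry 2 1) p w
        + (L.entry 2 2 p - (L.entry 0 0 p + L.entry 1 1 p + L.entry 2 2 p)) * fderiv ℝ (L.entry 2 2) p w) := by
  have h := entry_hasFDerivAt hd
  have h1 := ((((h 0 0).mul (h 1 1)).sub ((h 0 1).mul (h 1 0))).add
    (((h 0 0).mul (h 2 2)).sub ((h 0 2).mul (h 2 0)))).add
    (((h 1 1).mul (h 2 2)).sub ((h 1 2).mul (h 2 1)))
  have h2 : HasFDerivAt (sigma L 2) _ p :=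
    h1.congr_of_eventuallyEq (Eventually.of_forall fun q => sigma_two_eq L q)
  rw [h2.fderiv]
  simp
  ring

/-- Jacobi's formula `-tr(adj L · dL)`, written out with cofactors for the same use. -/
theorem fderiv_sigma_three_apply (hd : DifferentiableAt ℝ L p) (w : Coord 3) :
    fderiv ℝ (sigma L 3) p w =
      -((L.entry 1 1 p * L.entry 2 2 p - L.entry 1 2 p * L.entry 2 1 p) * fderiv ℝ (L.entry 0 0) p w
        + (-(L.entry 1 0 p * L.entry 2 2 p - L.entry 1 2 p * L.entry 2 0 p)) * fderiv ℝ (L.entry 0 1) p w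
        + (L.entry 1 0 p * L.entry 2 1 p - L.entry 1 1 p * L.entry 2 0 p) * fderiv ℝ (L.entry 0 2) p w
        + (-(L.entry 0 1 p * L.entry 2 2 p - L.entry 0 2 p * L.entry 2 1 p)) * fderiv ℝ (L.entry 1 0) p w
        + (L.entry 0 0 p * L.entry 2 2 p - L.entry 0 2 p * L.entry 2 0 p) * fderiv ℝ (L.entry 1 1) p w
        + (-(L.entry 0 0 p * L.entry 2 1 p - L.entry 0 1 p * L.entry 2 0 p)) * fderiv ℝ (L.entry 1 2) p w
        + (L.entry 0 1 p * L.entry 1 2 p - L.entry 0 2 p * L.entry 1 1 p) * fderiv ℝ (L.entry 2 0) p w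
        + (-(L.entry 0 0 p * L.entry 1 2 p - L.entry 0 2 p * L.entry 1 0 p)) * fderiv ℝ (L.entry 2 1) p w
        + (L.entry 0 0 p * L.entry 1 1 p - L.entry 0 1 p * L.entry 1 0 p) * fderiv ℝ (L.entry 2 2) p w) := by
  have h := entry_hasFDerivAt hd
  have h1 := ((((h 0 0).mul (((h 1 1).mul (h 2 2)).sub ((h 1 2).mul (h 2 1)))).sub
    ((h 0 1).mul (((h 1 0).mul (h 2 2)).sub ((h 1 2).mul (h 2 0))))).add
    ((h 0 2).mul (((h 1 0).mul (h 2 1)).sub ((h 1 1).mul (h 2 0))))).neg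
  have h2 : HasFDerivAt (sigma L 3) _ p :=
    h1.congr_of_eventuallyEq (Eventually.of_forall fun q => sigma_three_eq L q)
  rw [h2.fderiv]
  simp
  ring

theorem apply_single_eq_sum (φ : Coord 3 →L[ℝ] ℝ) (j : Fin 3) :
    φ (L p (Pi.single j 1)) = L.entry 0 j p * φ (Pi.single 0 1) + L.entry 1 j p * φ (Pi.single 1 1)
      + L.entry 2 j p * φ (Pi.single 2 1) := by
  conv_lhs => rw [pi_eq_sum_univ' (L p (Pi.single j 1))]
  simp [OpField.entry, Fin.sum_univ_three]

theorem ext_single {φ ψ : Coord 3 →L[ℝ] ℝ} (h₀ : φ (Pi.single 0 1) = ψ (Pi.single 0 1))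
    (h₁ : φ (Pi.single 1 1) = ψ (Pi.single 1 1)) (h₂ : φ (Pi.single 2 1) = ψ (Pi.single 2 1)) :
    φ = ψ := by
  ext v
  rw [pi_eq_sum_univ' v]
  simp [Fin.sum_univ_three, h₀, h₁, h₂]

/-- The trace of the torsion over its upper and second lower index: the two terms not containing a
trace of `dL` or `L dL` cancel. -/
theorem IsNijenhuisOn.fderiv_sigma_one_comp (hU : IsOpen U) (hL : IsNijenhuisOn L U) (hp : p ∈ U)
    (v : Coord 3) :
    fderiv ℝ (sigma L 1) p (L p v) = fderiv ℝ (sigma L 2) p v - sigma L 1 p * fderiv ℝ (sigma L 1) p v := by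
  have hd : DifferentiableAt ℝ L p :=
    ((hL.smooth p hp).contDiffAt (hU.mem_nhds hp)).differentiableAt (by simp)
  have N := hL.entry_identity hU hp
  simp only [Fin.sum_univ_three] at N
  suffices h : (fderiv ℝ (sigma L 1) p).comp (L p) = fderiv ℝ (sigma L 2) p - sigma L 1 p • fderiv ℝ (sigma L 1) p from
    DFunLike.congr_fun h v
  have hj := apply_single_eq_sum (L := L) (p := p) (fderiv ℝ (sigma L 1) p)
  refine ext_single ?_ ?_ ?_ <;>
    simp only [ContinuousLinearMap.comp_apply, _root_.sub_apply, _root_.smul_apply, smul_eq_mul, hj,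
      fderiv_sigma_one_apply hd, fderiv_sigma_two_apply hd,
      sigma_one_eq]
  · linear_combination - N 0 0 0 - N 1 0 1 - N 2 0 2
  · linear_combination - N 0 1 0 - N 1 1 1 - N 2 1 2
  · linear_combination - N 0 2 0 - N 1 2 1 - N 2 2 2

/-- Contraction of the torsion with `A = L + σ_1`. As `A` commutes with `L`, what survives is `tr(A
dL) ∘ L = tr(A L dL)`, and `A L = adj L - σ_2`. -/
theorem IsNijenhuisOn.fderiv_sigma_two_comp (hU : IsOpen U) (hL : IsNijenhuisOn L U) (hp : p ∈ U)
    (v : Coord 3) :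
    fderiv ℝ (sigma L 2) p (L p v) = fderiv ℝ (sigma L 3) p v - sigma L 2 p * fderiv ℝ (sigma L 1) p v := by
  have hd : DifferentiableAt ℝ L p :=
    ((hL.smooth p hp).contDiffAt (hU.mem_nhds hp)).differentiableAt (by simp)
  have N := hL.entry_identity hU hp
  simp only [Fin.sum_univ_three] at N
  suffices h : (fderiv ℝ (sigma L 2) p).comp (L p) = fderiv ℝ (sigma L 3) p - sigma L 2 p • fderiv ℝ (sigma L 1) p from
    DFunLike.congr_fun h v
  have hj := apply_single_eq_sum (L := L) (p := p) (fderiv ℝ (sigma L 2) p)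
  refine ext_single ?_ ?_ ?_ <;>
    simp only [ContinuousLinearMap.comp_apply, _root_.sub_apply, _root_.smul_apply, smul_eq_mul, hj,
      fderiv_sigma_one_apply hd, fderiv_sigma_two_apply hd,
      fderiv_sigma_three_apply hd, sigma_two_eq]
  · linear_combination - (L.entry 0 0 p - (L.entry 0 0 p + L.entry 1 1 p + L.entry 2 2 p)) * N 0 0 0
      - (L.entry 1 0 p) * N 0 0 1
      - (L.entry 2 0 p) * N 0 0 2
      - (L.entry 0 1 p) * N 1 0 0
      - (L.entry 1 1 p - (L.entry 0 0 p + L.entry 1 1 p + L.entry 2 2 p)) * N 1 0 1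
      - (L.entry 2 1 p) * N 1 0 2
      - (L.entry 0 2 p) * N 2 0 0
      - (L.entry 1 2 p) * N 2 0 1
      - (L.entry 2 2 p - (L.entry 0 0 p + L.entry 1 1 p + L.entry 2 2 p)) * N 2 0 2
  · linear_combination - (L.entry 0 0 p - (L.entry 0 0 p + L.entry 1 1 p + L.entry 2 2 p)) * N 0 1 0
      - (L.entry 1 0 p) * N 0 1 1
      - (L.entry 2 0 p) * N 0 1 2
      - (L.entry 0 1 p) * N 1 1 0
      - (L.entry 1 1 p - (L.entry 0 0 p + L.entry 1 1 p + L.entry 2 2 p)) * N 1 1 1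
      - (L.entry 2 1 p) * N 1 1 2
      - (L.entry 0 2 p) * N 2 1 0
      - (L.entry 1 2 p) * N 2 1 1
      - (L.entry 2 2 p - (L.entry 0 0 p + L.entry 1 1 p + L.entry 2 2 p)) * N 2 1 2
  · linear_combination - (L.entry 0 0 p - (L.entry 0 0 p + L.entry 1 1 p + L.entry 2 2 p)) * N 0 2 0
      - (L.entry 1 0 p) * N 0 2 1
      - (L.entry 2 0 p) * N 0 2 2
      - (L.entry 0 1 p) * N 1 2 0
      - (L.entry 1 1 p - (L.entry 0 0 p + L.entry 1 1 p + L.entry 2 2 p)) * N 1 2 1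
      - (L.entry 2 1 p) * N 1 2 2
      - (L.entry 0 2 p) * N 2 2 0
      - (L.entry 1 2 p) * N 2 2 1
      - (L.entry 2 2 p - (L.entry 0 0 p + L.entry 1 1 p + L.entry 2 2 p)) * N 2 2 2

/-- The same contraction with `A = adj L`; the chain closes because `adj L · L = det L = -σ_3`. -/
theorem IsNijenhuisOn.fderiv_sigma_three_comp (hU : IsOpen U) (hL : IsNijenhuisOn L U) (hp : p ∈ U)
    (v : Coord 3) :
    fderiv ℝ (sigma L 3) p (L p v) = -sigma L 3 p * fderiv ℝ (sigma L 1) p v := by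
  have hd : DifferentiableAt ℝ L p :=
    ((hL.smooth p hp).contDiffAt (hU.mem_nhds hp)).differentiableAt (by simp)
  have N := hL.entry_identity hU hp
  simp only [Fin.sum_univ_three] at N
  suffices h : (fderiv ℝ (sigma L 3) p).comp (L p) = -sigma L 3 p • fderiv ℝ (sigma L 1) p from
    DFunLike.congr_fun h v
  have hj := apply_single_eq_sum (L := L) (p := p) (fderiv ℝ (sigma L 3) p)
  refine ext_single ?_ ?_ ?_ <;>
    simp only [ContinuousLinearMap.comp_apply, _root_.smul_apply, smul_eq_mul, hj,
      fderiv_sigma_one_apply hd, fderiv_sigma_three_apply hd,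
      sigma_three_eq]
  · linear_combination - (L.entry 1 1 p * L.entry 2 2 p - L.entry 1 2 p * L.entry 2 1 p) * N 0 0 0
      - (-(L.entry 1 0 p * L.entry 2 2 p - L.entry 1 2 p * L.entry 2 0 p)) * N 0 0 1
      - (L.entry 1 0 p * L.entry 2 1 p - L.entry 1 1 p * L.entry 2 0 p) * N 0 0 2
      - (-(L.entry 0 1 p * L.entry 2 2 p - L.entry 0 2 p * L.entry 2 1 p)) * N 1 0 0
      - (L.entry 0 0 p * L.entry 2 2 p - L.entry 0 2 p * L.entry 2 0 p) * N 1 0 1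
      - (-(L.entry 0 0 p * L.entry 2 1 p - L.entry 0 1 p * L.entry 2 0 p)) * N 1 0 2
      - (L.entry 0 1 p * L.entry 1 2 p - L.entry 0 2 p * L.entry 1 1 p) * N 2 0 0
      - (-(L.entry 0 0 p * L.entry 1 2 p - L.entry 0 2 p * L.entry 1 0 p)) * N 2 0 1
      - (L.entry 0 0 p * L.entry 1 1 p - L.entry 0 1 p * L.entry 1 0 p) * N 2 0 2
  · linear_combination - (L.entry 1 1 p * L.entry 2 2 p - L.entry 1 2 p * L.entry 2 1 p) * N 0 1 0
      - (-(L.entry 1 0 p * L.entry 2 2 p - L.entry 1 2 p * L.entry 2 0 p)) * N 0 1 1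
      - (L.entry 1 0 p * L.entry 2 1 p - L.entry 1 1 p * L.entry 2 0 p) * N 0 1 2
      - (-(L.entry 0 1 p * L.entry 2 2 p - L.entry 0 2 p * L.entry 2 1 p)) * N 1 1 0
      - (L.entry 0 0 p * L.entry 2 2 p - L.entry 0 2 p * L.entry 2 0 p) * N 1 1 1
      - (-(L.entry 0 0 p * L.entry 2 1 p - L.entry 0 1 p * L.entry 2 0 p)) * N 1 1 2
      - (L.entry 0 1 p * L.entry 1 2 p - L.entry 0 2 p * L.entry 1 1 p) * N 2 1 0
      - (-(L.entry 0 0 p * L.entry 1 2 p - L.entry 0 2 p * L.entry 1 0 p)) * N 2 1 1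
      - (L.entry 0 0 p * L.entry 1 1 p - L.entry 0 1 p * L.entry 1 0 p) * N 2 1 2
  · linear_combination - (L.entry 1 1 p * L.entry 2 2 p - L.entry 1 2 p * L.entry 2 1 p) * N 0 2 0
      - (-(L.entry 1 0 p * L.entry 2 2 p - L.entry 1 2 p * L.entry 2 0 p)) * N 0 2 1
      - (L.entry 1 0 p * L.entry 2 1 p - L.entry 1 1 p * L.entry 2 0 p) * N 0 2 2
      - (-(L.entry 0 1 p * L.entry 2 2 p - L.entry 0 2 p * L.entry 2 1 p)) * N 1 2 0
      - (L.entry 0 0 p * L.entry 2 2 p - L.entry 0 2 p * L.entry 2 0 p) * N 1 2 1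
      - (-(L.entry 0 0 p * L.entry 2 1 p - L.entry 0 1 p * L.entry 2 0 p)) * N 1 2 2
      - (L.entry 0 1 p * L.entry 1 2 p - L.entry 0 2 p * L.entry 1 1 p) * N 2 2 0
      - (-(L.entry 0 0 p * L.entry 1 2 p - L.entry 0 2 p * L.entry 1 0 p)) * N 2 2 1
      - (L.entry 0 0 p * L.entry 1 1 p - L.entry 0 1 p * L.entry 1 0 p) * N 2 2 2

end Differentials

/-! ### Analytic tools: parameter integrals, cut-off, inverse function theorem. -/

/-- Differentiation under the integral produces an integral of the same kind with values in `E →L[ℝ]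
G`, so the induction must let `G` vary. The dominating constant comes from compactness of a closed
ball times `[0, 1]`. -/
theorem contDiff_intervalIntegral_nat {E G : Type} [NormedAddCommGroup E] [NormedSpace ℝ E]
    [ProperSpace E] [NormedAddCommGroup G] [NormedSpace ℝ G] [CompleteSpace G] (n : ℕ)
    {F : E → ℝ → G} (hF : ContDiff ℝ n (fun x : E × ℝ => F x.1 x.2)) :
    ContDiff ℝ n (fun x => ∫ t in (0 : ℝ)..1, F x t) := by
  induction n generalizing G with
  | zero =>
    rw [Nat.cast_zero, contDiff_zero] at *
    exact intervalIntegral.continuous_parametric_intervalIntegral_of_continuous' hF 0 1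
  | succ n ih =>
    have hF1 : ContDiff ℝ 1 (fun x : E × ℝ => F x.1 x.2) := hF.of_le (by simp)
    set F' : E → ℝ → (E →L[ℝ] G) := fun x t =>
      (fderiv ℝ (fun x : E × ℝ => F x.1 x.2) (x, t)).comp (ContinuousLinearMap.inl ℝ E ℝ) with hF'
    have hF'n : ContDiff ℝ n (fun x : E × ℝ => F' x.1 x.2) := by
      have h := hF.fderiv_right (m := n) (by simp)
      exact h.clm_comp contDiff_const
    have hF'c : Continuous (fun x : E × ℝ => F' x.1 x.2) := hF'n.continuous
    have hder : ∀ x t, HasFDerivAt (fun x => F x t) (F' x t) x := by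
      intro x t
      have h1 : HasFDerivAt (fun x : E × ℝ => F x.1 x.2)
        (fderiv ℝ (fun x : E × ℝ => F x.1 x.2) (x, t)) (x, t) :=
        ((hF1.differentiable (by simp)) (x, t)).hasFDerivAt
      have h2 : HasFDerivAt (fun x : E => (x, t)) (ContinuousLinearMap.inl ℝ E ℝ) x :=
        hasFDerivAt_prodMk_left x t
      exact h1.comp x h2
    have hmain : ∀ x₀, HasFDerivAt (fun x => ∫ t in (0 : ℝ)..1, F x t)
        (∫ t in (0 : ℝ)..1, F' x₀ t) x₀ := by
      intro x₀
      obtain ⟨C, hC⟩ := ((isCompact_closedBall x₀ 1).prod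
        (isCompact_Icc (a := (0 : ℝ)) (b := 1))).exists_bound_of_continuousOn hF'c.continuousOn
      refine (intervalIntegral.hasFDerivAt_integral_of_dominated_of_fderiv_le
        (bound := fun _ => C) (Metric.ball_mem_nhds x₀ one_pos) ?_ ?_ ?_ ?_ ?_ ?_)
      · refine Eventually.of_forall fun x => ?_
        exact (hF.continuous.comp (by fun_prop : Continuous fun t : ℝ => (x, t))).aestronglyMeasurable
      · exact (hF.continuous.comp
          (by fun_prop : Continuous fun t : ℝ => (x₀, t))).intervalIntegrable _ _
      · exact (hF'c.comp (by fun_prop : Continuous fun t : ℝ => (x₀, t))).aestronglyMeasurable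
      · refine Eventually.of_forall fun t ht x hx => ?_
        rw [uIoc_of_le zero_le_one] at ht
        exact hC (x, t) ⟨Metric.ball_subset_closedBall hx, ht.1.le, ht.2⟩
      · exact intervalIntegrable_const
      · exact Eventually.of_forall fun t _ x _ => hder x t
    have hfd : fderiv ℝ (fun x => ∫ t in (0 : ℝ)..1, F x t) = fun x => ∫ t in (0 : ℝ)..1, F' x t :=
      funext fun x => (hmain x).fderiv
    rw [Nat.cast_add, Nat.cast_one, contDiff_succ_iff_fderiv]
    refine ⟨fun x => (hmain x).differentiableAt, fun h => absurd h (by simp), ?_⟩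
    rw [hfd]
    exact ih hF'n

theorem contDiff_intervalIntegral {E G : Type} [NormedAddCommGroup E] [NormedSpace ℝ E]
    [ProperSpace E] [NormedAddCommGroup G] [NormedSpace ℝ G] [CompleteSpace G]
    {F : E → ℝ → G} (hF : ContDiff ℝ ∞ (fun x : E × ℝ => F x.1 x.2)) :
    ContDiff ℝ ∞ (fun x => ∫ t in (0 : ℝ)..1, F x t) :=
  contDiff_infty.2 fun n => contDiff_intervalIntegral_nat n (contDiff_infty.1 hF n)

/-- A function that is smooth on a ball agrees on a smaller ball with a globally smooth one. -/
theorem exists_contDiff_eqOn_ball {n : ℕ} {k : Coord n → ℝ} {r : ℝ} (hr : 0 < r)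
    (hk : ContDiffOn ℝ ∞ k (Metric.ball 0 r)) :
    ∃ K : Coord n → ℝ, ContDiff ℝ ∞ K ∧ EqOn K k (Metric.ball 0 (r / 4)) := by
  let χ : ContDiffBump (0 : Coord n) := ⟨r / 4, r / 2, by positivity, by linarith⟩
  refine ⟨fun q => χ q * k q, ?_, fun q hq => ?_⟩
  · rw [contDiff_iff_contDiffAt]
    intro q
    by_cases hq : q ∈ Metric.ball (0 : Coord n) r
    · exact χ.contDiff.contDiffAt.mul ((hk q hq).contDiffAt (Metric.isOpen_ball.mem_nhds hq))
    · have h1 : q ∉ tsupport χ := by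
        rw [χ.tsupport_eq]
        intro h
        have h2 : dist q 0 ≤ r / 2 := h
        rw [Metric.mem_ball] at hq
        linarith
      have h2 := notMem_tsupport_iff_eventuallyEq.1 h1
      refine (contDiffAt_const (c := (0 : ℝ))).congr_of_eventuallyEq ?_
      filter_upwards [h2] with x hx
      simp [hx]
  · have : χ q = 1 := χ.one_of_mem_closedBall (Metric.ball_subset_closedBall hq)
    simp [this]

/-- The inverse function theorem for smooth maps of coordinate space, with the domain cut down
so that the image is a ball. -/
theorem exists_isSmoothChange {n : ℕ} {Φ : Coord n → Coord n} {U V : Set (Coord n)}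
    (hU : IsOpen U) (h0 : 0 ∈ U) (hΦ : ContDiffOn ℝ ∞ Φ U) (hΦ0 : Φ 0 = 0)
    (hinj : ∀ w, fderiv ℝ Φ 0 w = 0 → w = 0) (hV : V ∈ 𝓝 0) :
    ∃ φ : OpenPartialHomeomorph (Coord n) (Coord n), IsSmoothChange φ ∧ (φ : Coord n → Coord n) = Φ ∧
      0 ∈ φ.source ∧ φ.source ⊆ U ∩ V ∧ ∃ r > 0, φ.target = Metric.ball 0 r := by
  have hΦat : ∀ p ∈ U, ContDiffAt ℝ ∞ Φ p := fun p hp => (hΦ p hp).contDiffAt (hU.mem_nhds hp)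
  let A : Coord n ≃L[ℝ] Coord n := (LinearEquiv.ofInjectiveEndo
    (fderiv ℝ Φ 0 : Coord n →ₗ[ℝ] Coord n)
    ((injective_iff_map_eq_zero _).2 hinj)).toContinuousLinearEquiv
  have hA : (A : Coord n →L[ℝ] Coord n) = fderiv ℝ Φ 0 := by
    ext1 w; rfl
  have hd : HasFDerivAt Φ (A : Coord n →L[ℝ] Coord n) 0 := by
    rw [hA]; exact ((hΦat 0 h0).differentiableAt (by simp)).hasFDerivAt
  let e := (hΦat 0 h0).toOpenPartialHomeomorph Φ hd (by simp)
  have he0 : 0 ∈ e.source := (hΦat 0 h0).mem_toOpenPartialHomeomorph_source hd (by simp)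
  have hfc : ContinuousOn (fderiv ℝ Φ) U := hΦ.continuousOn_fderiv_of_isOpen hU (by simp)
  -- Invertibility of the derivative on the whole source, not only at `0`, makes the inverse smooth
  -- at every point of the target.
  let S : Set (Coord n) := (U ∩ fderiv ℝ Φ ⁻¹' range
    ((↑) : (Coord n ≃L[ℝ] Coord n) → Coord n →L[ℝ] Coord n)) ∩ interior V
  have hS : IsOpen S :=
    (hfc.isOpen_inter_preimage hU (ContinuousLinearEquiv.isOpen)).inter isOpen_interior
  have hS0 : 0 ∈ S := ⟨⟨h0, A, hA⟩, mem_interior_iff_mem_nhds.2 hV⟩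
  let e₁ := e.restrOpen S hS
  have he₁s : e₁.source = e.source ∩ S := rfl
  have h01 : (0 : Coord n) ∈ e₁.target := by
    have h := e₁.map_source (he₁s ▸ ⟨he0, hS0⟩ : (0 : Coord n) ∈ e₁.source)
    rwa [show e₁ 0 = 0 from hΦ0] at h
  obtain ⟨r, hr, hball⟩ := Metric.isOpen_iff.1 e₁.open_target 0 h01
  let e₂ := (e₁.symm.restrOpen (Metric.ball 0 r) Metric.isOpen_ball).symm
  have he₂ : (e₂ : Coord n → Coord n) = Φ := rfl
  have ht : e₂.target = Metric.ball 0 r := by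
    change e₁.target ∩ Metric.ball 0 r = _
    exact inter_eq_right.2 hball
  have hsrc : e₂.source ⊆ S := by
    intro p hp
    have h : p ∈ e₁.symm.target ∩ e₁.symm.symm ⁻¹' Metric.ball 0 r := hp
    exact (show p ∈ e.source ∩ S from h.1).2
  have hs0 : (0 : Coord n) ∈ e₂.source := by
    have h := e₂.map_target (ht ▸ Metric.mem_ball_self hr : (0 : Coord n) ∈ e₂.target)
    have h2 : e₂.symm 0 = 0 := by
      have h3 := e.left_inv he0
      rw [show e 0 = 0 from hΦ0] at h3
      exact h3
    rwa [h2] at h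
  refine ⟨e₂, ⟨?_, ?_⟩, he₂, hs0, fun p hp => ⟨(hsrc hp).1.1, interior_subset (hsrc hp).2⟩,
    r, hr, ht⟩
  · exact hΦ.mono fun p hp => (hsrc hp).1.1
  · intro q hq
    obtain ⟨B, hB⟩ := (hsrc (e₂.map_target hq)).1.2
    have hU' := (hsrc (e₂.map_target hq)).1.1
    refine (e₂.contDiffAt_symm hq (f₀' := B) ?_ (hΦat _ hU')).contDiffWithinAt
    rw [hB]
    exact ((hΦat _ hU').differentiableAt (by simp)).hasFDerivAt

/-! ### The Morse lemma with parameters. -/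

/-- Scaling of the first coordinate. -/
def scaleFirst (s : ℝ) (q : Coord 3) : Coord 3 := ![s * q 0, q 1, q 2]

theorem scaleFirst_one (q : Coord 3) : scaleFirst 1 q = q := by
  ext i; fin_cases i <;> simp [scaleFirst]

theorem scaleFirst_mem_ball {s r : ℝ} (h₀ : 0 ≤ s) (h₁ : s ≤ 1) {q : Coord 3}
    (hq : q ∈ Metric.ball (0 : Coord 3) r) : scaleFirst s q ∈ Metric.ball (0 : Coord 3) r := by
  rw [mem_ball_zero_iff] at *
  refine lt_of_le_of_lt ((pi_norm_le_iff_of_nonneg (norm_nonneg q)).2 fun i => ?_) hq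
  fin_cases i
  · have h : |s * q 0| ≤ |q 0| := by
      rw [abs_mul, abs_of_nonneg h₀]
      exact mul_le_of_le_one_left (abs_nonneg _) h₁
    exact h.trans (norm_le_pi_norm q 0)
  · exact norm_le_pi_norm q 1
  · exact norm_le_pi_norm q 2

theorem contDiff_scaleFirst : ContDiff ℝ ∞ (fun x : Coord 3 × ℝ => scaleFirst x.2 x.1) := by
  refine contDiff_pi.2 fun i => ?_
  fin_cases i
  · change ContDiff ℝ ∞ (fun x : Coord 3 × ℝ => x.2 * x.1 0)
    fun_prop
  · change ContDiff ℝ ∞ (fun x : Coord 3 × ℝ => x.1 1)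
    fun_prop
  · change ContDiff ℝ ∞ (fun x : Coord 3 × ℝ => x.1 2)
    fun_prop

theorem hasDerivAt_scaleFirst (q : Coord 3) (t : ℝ) :
    HasDerivAt (fun s => scaleFirst s q) (q 0 • Pi.single 0 1) t := by
  refine hasDerivAt_pi.2 fun i => ?_
  fin_cases i
  · simpa [scaleFirst] using (hasDerivAt_id t).mul_const (q 0)
  · simpa [scaleFirst] using hasDerivAt_const t (q 1)
  · simpa [scaleFirst] using hasDerivAt_const t (q 2)

/-- A Morse lemma with parameters: if `∂₀ f = q₀ k` with `k` smooth and `k 0 ≠ 0`, then near the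
origin `f` is `± X²` plus a function of the last two coordinates. -/
theorem exists_square_decomposition {f k : Coord 3 → ℝ} {r : ℝ} (hr : 0 < r)
    (hf : ∀ q ∈ Metric.ball (0 : Coord 3) r, DifferentiableAt ℝ f q)
    (hk : ContDiffOn ℝ ∞ k (Metric.ball 0 r))
    (hfk : ∀ q ∈ Metric.ball (0 : Coord 3) r, fderiv ℝ f q (Pi.single 0 1) = q 0 * k q)
    (hk0 : k 0 ≠ 0) :
    ∃ ε : ℝ, (ε = 1 ∨ ε = -1) ∧ ∃ X : Coord 3 → ℝ, ∃ V : Set (Coord 3), IsOpen V ∧ 0 ∈ V ∧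
      V ⊆ Metric.ball 0 r ∧ ContDiffOn ℝ ∞ X V ∧ X 0 = 0 ∧
      (∀ w, fderiv ℝ X 0 w = 0 → w 0 = 0) ∧
      ∀ q ∈ V, f q = f (scaleFirst 0 q) + ε * X q ^ 2 := by
  -- The cut-off makes the integrand below globally smooth, as `contDiff_intervalIntegral` requires.
  obtain ⟨K, hK, hKk⟩ := exists_contDiff_eqOn_ball hr hk
  -- Integrating `∂₀ f = q₀ k` along `t ↦ (t q₀, q₁, q₂)` gives the increment of `f` as `q₀² G`. The
  -- weight `t` comes from the factor `q₀` in `∂₀ f`, whence `G 0 = k 0 / 2`.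
  let G : Coord 3 → ℝ := fun q => ∫ t in (0 : ℝ)..1, t * K (scaleFirst t q)
  have hint : ContDiff ℝ ∞ (fun x : Coord 3 × ℝ => x.2 * K (scaleFirst x.2 x.1)) :=
    contDiff_snd.mul (hK.comp contDiff_scaleFirst)
  have hG : ContDiff ℝ ∞ G :=
    contDiff_intervalIntegral (F := fun q t => t * K (scaleFirst t q)) hint
  have hr4 : Metric.ball (0 : Coord 3) (r / 4) ⊆ Metric.ball 0 r :=
    Metric.ball_subset_ball (by linarith)
  have hfG : ∀ q ∈ Metric.ball (0 : Coord 3) (r / 4), f q = f (scaleFirst 0 q) + q 0 ^ 2 * G q := by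
    intro q hq
    have h1 : ∫ t in (0 : ℝ)..1, q 0 ^ 2 * (t * K (scaleFirst t q))
        = f (scaleFirst 1 q) - f (scaleFirst 0 q) := by
      refine intervalIntegral.integral_eq_sub_of_hasDerivAt (f := fun t => f (scaleFirst t q))
        (fun t ht => ?_) ?_
      · rw [uIcc_of_le zero_le_one] at ht
        have hm := scaleFirst_mem_ball ht.1 ht.2 hq
        have h2 := (hf _ (hr4 hm)).hasFDerivAt.comp_hasDerivAt t (hasDerivAt_scaleFirst q t)
        refine h2.congr_deriv ?_
        rw [map_smul, hfk _ (hr4 hm), hKk hm]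
        simp [scaleFirst]
        ring
      · have hc : Continuous (fun t : ℝ => q 0 ^ 2 * (t * K (scaleFirst t q))) :=
          continuous_const.mul (hint.continuous.comp (by fun_prop : Continuous fun t : ℝ => (q, t)))
        exact hc.intervalIntegrable _ _
    rw [intervalIntegral.integral_const_mul, scaleFirst_one] at h1
    change q 0 ^ 2 * G q = _ at h1
    linarith
  have hG0 : G 0 = k 0 / 2 := by
    have h1 : ∀ t : ℝ, scaleFirst t 0 = 0 := by
      intro t; ext i; fin_cases i <;> simp [scaleFirst]
    simp only [G, h1, intervalIntegral.integral_mul_const, integral_id]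
    rw [hKk (Metric.mem_ball_self (by positivity))]
    ring
  obtain ⟨ε, hε, hεG⟩ : ∃ ε : ℝ, (ε = 1 ∨ ε = -1) ∧ 0 < ε * G 0 := by
    rcases lt_or_gt_of_ne hk0 with h | h
    · exact ⟨-1, Or.inr rfl, by rw [hG0]; linarith⟩
    · exact ⟨1, Or.inl rfl, by rw [hG0]; linarith⟩
  have hεε : ε * ε = 1 := by rcases hε with rfl | rfl <;> norm_num
  have hεGc : ContDiff ℝ ∞ (fun q => ε * G q) := contDiff_const.mul hG
  let V : Set (Coord 3) := Metric.ball 0 (r / 4) ∩ {q | 0 < ε * G q}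
  have hV : IsOpen V := Metric.isOpen_ball.inter (isOpen_lt continuous_const hεGc.continuous)
  have hV0 : (0 : Coord 3) ∈ V := ⟨Metric.mem_ball_self (by positivity), hεG⟩
  have hsq : ContDiffOn ℝ ∞ (fun q => Real.sqrt (ε * G q)) V := fun q hq =>
    (hεGc.contDiffAt.sqrt (ne_of_gt hq.2)).contDiffWithinAt
  refine ⟨ε, hε, fun q => q 0 * Real.sqrt (ε * G q), V, hV, hV0, fun q hq => hr4 hq.1,
    (by fun_prop : ContDiff ℝ ∞ fun q : Coord 3 => q 0).contDiffOn.mul hsq, by simp, ?_, ?_⟩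
  · intro w hw
    have h1 : HasFDerivAt (fun q : Coord 3 => q 0)
      (ContinuousLinearMap.proj (R := ℝ) (φ := fun _ : Fin 3 => ℝ) 0) 0 :=
      hasFDerivAt_apply 0 0
    have h2 := (((hsq 0 hV0).contDiffAt (hV.mem_nhds hV0)).differentiableAt (by simp)).hasFDerivAt
    have h3 := h1.fun_mul h2
    have h4 : fderiv ℝ (fun q : Coord 3 => q 0 * Real.sqrt (ε * G q)) 0 w
        = Real.sqrt (ε * G 0) * w 0 := by
      rw [HasFDerivAt.fderiv h3]
      simp
    rw [h4] at hw
    exact (mul_eq_zero.1 hw).resolve_left (Real.sqrt_pos.2 hεG).ne'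
  · intro q hq
    rw [hfG q hq.1, mul_pow, Real.sq_sqrt hq.2.le]
    linear_combination (- q 0 ^ 2 * G q) * hεε

/-! ### The Clairaut system. -/

/-- The first-order system satisfied by the critical values forces them to be affine. -/
theorem eq_affine_of_clairaut {f : Coord 3 → ℝ} {r : ℝ} (hr : 0 < r)
    (hf : ContDiffOn ℝ ∞ f (Metric.ball 0 r))
    (h₁ : ∀ q ∈ Metric.ball (0 : Coord 3) r, q 0 = 0 →
      (f q - (q 1 * fderiv ℝ f q (Pi.single 1 1) + q 2 * fderiv ℝ f q (Pi.single 2 1)))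
        * fderiv ℝ f q (Pi.single 1 1) = 1)
    (h₂ : ∀ q ∈ Metric.ball (0 : Coord 3) r, q 0 = 0 →
      (f q - (q 1 * fderiv ℝ f q (Pi.single 1 1) + q 2 * fderiv ℝ f q (Pi.single 2 1)))
        * fderiv ℝ f q (Pi.single 2 1) = - fderiv ℝ f q (Pi.single 1 1)) :
    f 0 ≠ 0 ∧ ∃ r' > 0, ∀ q ∈ Metric.ball (0 : Coord 3) r',
      f (scaleFirst 0 q) = q 1 / f 0 - q 2 / f 0 ^ 2 + f 0 := by
  have hB : IsOpen (Metric.ball (0 : Coord 3) r) := Metric.isOpen_ball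
  have h00 : (0 : Coord 3) ∈ Metric.ball (0 : Coord 3) r := Metric.mem_ball_self hr
  have hsm : ∀ q ∈ Metric.ball (0 : Coord 3) r, scaleFirst 0 q ∈ Metric.ball (0 : Coord 3) r :=
    fun q hq => scaleFirst_mem_ball le_rfl zero_le_one hq
  have hs0 : scaleFirst 0 0 = 0 := by
    ext i; fin_cases i <;> simp [scaleFirst]
  let A : Coord 3 →L[ℝ] Coord 3 := ContinuousLinearMap.pi
    ![0, ContinuousLinearMap.proj 1, ContinuousLinearMap.proj 2]
  have hA : ∀ q, A q = scaleFirst 0 q := by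
    intro q; ext i; fin_cases i <;> simp [A, scaleFirst]
  have hsc : ContDiff ℝ ∞ (scaleFirst 0) := by
    rw [← funext hA]; exact A.contDiff
  have hsd : ∀ q, HasFDerivAt (scaleFirst 0) A q := by
    intro q; rw [← funext hA]; exact A.hasFDerivAt
  let P : Coord 3 → ℝ := fun q => fderiv ℝ f (scaleFirst 0 q) (Pi.single 1 1)
  have hP : ContDiffOn ℝ ∞ P (Metric.ball 0 r) := by
    have h := (hf.fderiv_of_isOpen hB (m := ∞) (by simp)).comp hsc.contDiffOn hsm
    exact h.clm_apply contDiffOn_const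
  have hPne : ∀ q ∈ Metric.ball (0 : Coord 3) r, P q ≠ 0 := by
    intro q hq h
    have := h₁ _ (hsm q hq) (by simp [scaleFirst])
    rw [show fderiv ℝ f (scaleFirst 0 q) (Pi.single 1 1) = 0 from h] at this
    simp at this
  -- Multiply the second equation by `P` and eliminate the common factor with the first.
  have hQ : ∀ q ∈ Metric.ball (0 : Coord 3) r,
      fderiv ℝ f (scaleFirst 0 q) (Pi.single 2 1) = -P q ^ 2 := by
    intro q hq
    have e1 := h₁ _ (hsm q hq) (by simp [scaleFirst])
    have e2 := h₂ _ (hsm q hq) (by simp [scaleFirst])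
    change _ * P q = 1 at e1
    change _ = - P q at e2
    linear_combination P q * e2 - fderiv ℝ f (scaleFirst 0 q) (Pi.single 2 1) * e1
  have hg : ∀ q ∈ Metric.ball (0 : Coord 3) r,
      f (scaleFirst 0 q) = q 1 * P q - q 2 * P q ^ 2 + (P q)⁻¹ := by
    intro q hq
    have e1 := h₁ _ (hsm q hq) (by simp [scaleFirst])
    rw [hQ q hq] at e1
    change (f (scaleFirst 0 q) - (q 1 * P q + q 2 * _)) * P q = 1 at e1
    have := eq_inv_of_mul_eq_one_left e1
    linarith
  have hf0 : f 0 * P 0 = 1 := by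
    have e1 := h₁ 0 h00 rfl
    simpa [P, hs0] using e1
  have hne : f 0 ≠ 0 := left_ne_zero_of_mul_eq_one hf0
  have hfP : P 0 = (f 0)⁻¹ := eq_inv_of_mul_eq_one_right hf0
  have hPd : ∀ q ∈ Metric.ball (0 : Coord 3) r, HasFDerivAt P (fderiv ℝ P q) q := fun q hq =>
    (((hP q hq).contDiffAt (hB.mem_nhds hq)).differentiableAt (by simp)).hasFDerivAt
  -- Differentiating `g = yP - zP² + 1/P` and subtracting `dg = P dy - P² dz` leaves only the terms
  -- in `dP`.
  have hkey : ∀ q ∈ Metric.ball (0 : Coord 3) r, ∀ w,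
      (q 1 - 2 * q 2 * P q - (P q ^ 2)⁻¹) * fderiv ℝ P q w = 0 := by
    intro q hq w
    have hproj : ∀ i : Fin 3, HasFDerivAt (fun q : Coord 3 => q i)
      (ContinuousLinearMap.proj (R := ℝ) (φ := fun _ : Fin 3 => ℝ) i) q := fun i =>
      hasFDerivAt_apply i q
    have hfd : HasFDerivAt f (fderiv ℝ f (scaleFirst 0 q)) (scaleFirst 0 q) :=
      (((hf _ (hsm q hq)).contDiffAt (hB.mem_nhds (hsm q hq))).differentiableAt
        (by simp)).hasFDerivAt
    have d1 := hfd.comp q (hsd q)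
    have d2 := (((hproj 1).mul (hPd q hq)).sub ((hproj 2).mul ((hPd q hq).pow 2))).add
      ((hasDerivAt_inv (hPne q hq)).comp_hasFDerivAt q (hPd q hq))
    have heq : (f ∘ scaleFirst 0) =ᶠ[𝓝 q] (fun q => q 1 * P q - q 2 * P q ^ 2 + (P q)⁻¹) := by
      filter_upwards [hB.mem_nhds hq] with x hx using hg x hx
    have d3 := DFunLike.congr_fun (d1.unique (d2.congr_of_eventuallyEq heq)) w
    have hw : scaleFirst 0 w = w 1 • Pi.single 1 1 + w 2 • Pi.single 2 1 := by
      ext i; fin_cases i <;> simp [scaleFirst]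
    have hL : fderiv ℝ f (scaleFirst 0 q) (A w) = w 1 * P q - w 2 * P q ^ 2 := by
      rw [hA, hw, map_add, map_smul, map_smul, hQ q hq]
      simp only [smul_eq_mul, P]
      ring
    rw [ContinuousLinearMap.comp_apply, hL] at d3
    simp at d3
    linear_combination -d3
  -- At the origin the factor equals `-1/P²`, so it is nonzero nearby and the singular Clairaut
  -- solution is excluded.
  have hfac : ∀ᶠ q in 𝓝 (0 : Coord 3), q 1 - 2 * q 2 * P q - (P q ^ 2)⁻¹ ≠ 0 := by
    have hPc : ContinuousAt P 0 := (hPd 0 h00).continuousAt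
    have hc : ContinuousAt (fun q : Coord 3 => q 1 - 2 * q 2 * P q - (P q ^ 2)⁻¹) 0 := by
      refine ContinuousAt.sub (ContinuousAt.sub (continuous_apply 1).continuousAt
        (ContinuousAt.mul (continuous_const.mul (continuous_apply 2)).continuousAt hPc))
        (ContinuousAt.inv₀ (hPc.pow 2) (pow_ne_zero 2 (hPne 0 h00)))
    refine hc.eventually_ne ?_
    simpa using hPne 0 h00
  obtain ⟨r', hr', hsub⟩ := Metric.eventually_nhds_iff_ball.1
    (hfac.and (hB.eventually_mem h00))
  refine ⟨hne, r', hr', fun q hq => ?_⟩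
  have hconst : P q = P 0 := by
    refine (convex_ball (0 : Coord 3) r').is_const_of_fderivWithin_eq_zero (𝕜 := ℝ) (f := P)
      (fun x hx => (hPd x (hsub x hx).2).differentiableAt.differentiableWithinAt) (fun x hx => ?_)
      hq (Metric.mem_ball_self hr')
    rw [fderivWithin_of_isOpen Metric.isOpen_ball hx]
    ext1 w
    exact (mul_eq_zero.1 (hkey x (hsub x hx).2 w)).resolve_left (hsub x hx).1
  rw [hg q (hsub q hq).2, hconst, hfP]
  field_simp

/-! ### Cross products of covectors and the Jacobian. -/

/-- The vector annihilated by two covectors (their cross product). -/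
def crossCovectors (b c : Coord 3 →L[ℝ] ℝ) : Coord 3 :=
  ![b (Pi.single 1 1) * c (Pi.single 2 1) - b (Pi.single 2 1) * c (Pi.single 1 1),
    b (Pi.single 2 1) * c (Pi.single 0 1) - b (Pi.single 0 1) * c (Pi.single 2 1),
    b (Pi.single 0 1) * c (Pi.single 1 1) - b (Pi.single 1 1) * c (Pi.single 0 1)]

theorem covector_apply (a : Coord 3 →L[ℝ] ℝ) (w : Coord 3) :
    a w = w 0 * a (Pi.single 0 1) + w 1 * a (Pi.single 1 1) + w 2 * a (Pi.single 2 1) := by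
  conv_lhs => rw [pi_eq_sum_univ' w]
  simp [Fin.sum_univ_three]

theorem apply_crossCovectors_left (b c : Coord 3 →L[ℝ] ℝ) : b (crossCovectors b c) = 0 := by
  rw [covector_apply]
  simp [crossCovectors]
  ring

theorem apply_crossCovectors_right (b c : Coord 3 →L[ℝ] ℝ) : c (crossCovectors b c) = 0 := by
  rw [covector_apply]
  simp [crossCovectors]
  ring

/-- With `N = b × c`, the triple product gives `w × N = 0`, and expanding `N × (w × N) = 0` is the
claim. Keeping `N·N` as a factor avoids division: `w` is parallel to `N` once `N ≠ 0`. -/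
theorem smul_eq_of_mem_ker {b c : Coord 3 →L[ℝ] ℝ} {w : Coord 3} (hb : b w = 0) (hc : c w = 0) :
    (crossCovectors b c ⬝ᵥ crossCovectors b c) • w
      = (crossCovectors b c ⬝ᵥ w) • crossCovectors b c := by
  rw [covector_apply] at hb hc
  ext i
  fin_cases i <;>
    simp only [crossCovectors, dotProduct, Fin.sum_univ_three, Pi.smul_apply, smul_eq_mul,
      Matrix.cons_val_zero, Matrix.cons_val_one, Matrix.cons_val, Fin.zero_eta, Fin.mk_one,
      Fin.reduceFinMk, Fin.isValue]
  · linear_combination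
      ((b (Pi.single 2 1) * c (Pi.single 0 1) - b (Pi.single 0 1) * c (Pi.single 2 1))
          * c (Pi.single 2 1)
        - (b (Pi.single 0 1) * c (Pi.single 1 1) - b (Pi.single 1 1) * c (Pi.single 0 1))
          * c (Pi.single 1 1)) * (-hb)
      + ((b (Pi.single 2 1) * c (Pi.single 0 1) - b (Pi.single 0 1) * c (Pi.single 2 1))
          * b (Pi.single 2 1)
        - (b (Pi.single 0 1) * c (Pi.single 1 1) - b (Pi.single 1 1) * c (Pi.single 0 1))
          * b (Pi.single 1 1)) * hc
  · linear_combination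
      ((b (Pi.single 0 1) * c (Pi.single 1 1) - b (Pi.single 1 1) * c (Pi.single 0 1))
          * c (Pi.single 0 1)
        - (b (Pi.single 1 1) * c (Pi.single 2 1) - b (Pi.single 2 1) * c (Pi.single 1 1))
          * c (Pi.single 2 1)) * (-hb)
      + ((b (Pi.single 0 1) * c (Pi.single 1 1) - b (Pi.single 1 1) * c (Pi.single 0 1))
          * b (Pi.single 0 1)
        - (b (Pi.single 1 1) * c (Pi.single 2 1) - b (Pi.single 2 1) * c (Pi.single 1 1))
          * b (Pi.single 2 1)) * hc
  · linear_combination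
      ((b (Pi.single 1 1) * c (Pi.single 2 1) - b (Pi.single 2 1) * c (Pi.single 1 1))
          * c (Pi.single 1 1)
        - (b (Pi.single 2 1) * c (Pi.single 0 1) - b (Pi.single 0 1) * c (Pi.single 2 1))
          * c (Pi.single 0 1)) * (-hb)
      + ((b (Pi.single 1 1) * c (Pi.single 2 1) - b (Pi.single 2 1) * c (Pi.single 1 1))
          * b (Pi.single 1 1)
        - (b (Pi.single 2 1) * c (Pi.single 0 1) - b (Pi.single 0 1) * c (Pi.single 2 1))
          * b (Pi.single 0 1)) * hc

theorem crossCovectors_ne_zero {b c : Coord 3 →L[ℝ] ℝ} (h : LinearIndependent ℝ ![b, c]) :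
    crossCovectors b c ≠ 0 := by
  intro h0
  have e0 := congrFun h0 0
  have e1 := congrFun h0 1
  have e2 := congrFun h0 2
  simp only [crossCovectors, Matrix.cons_val_zero, Matrix.cons_val_one, Matrix.cons_val,
    Pi.zero_apply] at e0 e1 e2
  have h1 := linearIndependent_fin2.1 h
  simp only [Matrix.cons_val_zero, Matrix.cons_val_one] at h1
  obtain ⟨hc, hbc⟩ := h1
  have hsome : ∀ i : Fin 3, c (Pi.single i 1) = 0 := by
    intro i
    by_contra hi
    -- If the `i`-th component of `c` is nonzero, the vanishing minors make `b` a multiple of `c`,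
    -- with ratio read off at `i`.
    refine hbc (b (Pi.single i 1) / c (Pi.single i 1)) (ext_single ?_ ?_ ?_) <;>
      simp only [_root_.smul_apply, smul_eq_mul] <;> field_simp <;> fin_cases i <;>
      simp only [Fin.zero_eta, Fin.mk_one, Fin.reduceFinMk, Fin.isValue] <;> linarith
  exact hc (ext_single (by simp [hsome]) (by simp [hsome]) (by simp [hsome]))

section

variable {U : Set (Coord 3)} {s₁ s₂ s₃ : Coord 3 → ℝ}

/-- The coefficient of `ds₁ ∧ ds₂ ∧ ds₃`. -/
noncomputable def jacobian (s₁ s₂ s₃ : Coord 3 → ℝ) (p : Coord 3) : ℝ :=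
  fderiv ℝ s₁ p (crossCovectors (fderiv ℝ s₂ p) (fderiv ℝ s₃ p))

theorem contDiffOn_fderiv_apply (hU : IsOpen U) (h : ContDiffOn ℝ ∞ s₁ U) (v : Coord 3) :
    ContDiffOn ℝ ∞ (fun p => fderiv ℝ s₁ p v) U :=
  (h.fderiv_of_isOpen hU (m := ∞) (by simp)).clm_apply contDiffOn_const

theorem contDiffOn_crossCovectors (hU : IsOpen U) (h₂ : ContDiffOn ℝ ∞ s₂ U)
    (h₃ : ContDiffOn ℝ ∞ s₃ U) :
    ContDiffOn ℝ ∞ (fun p => crossCovectors (fderiv ℝ s₂ p) (fderiv ℝ s₃ p)) U := by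
  have d2 := contDiffOn_fderiv_apply hU h₂
  have d3 := contDiffOn_fderiv_apply hU h₃
  refine contDiffOn_pi.2 fun i => ?_
  fin_cases i
  · exact ((d2 _).mul (d3 _)).sub ((d2 _).mul (d3 _))
  · exact ((d2 _).mul (d3 _)).sub ((d2 _).mul (d3 _))
  · exact ((d2 _).mul (d3 _)).sub ((d2 _).mul (d3 _))

theorem contDiffOn_jacobian (hU : IsOpen U) (h₁ : ContDiffOn ℝ ∞ s₁ U)
    (h₂ : ContDiffOn ℝ ∞ s₂ U) (h₃ : ContDiffOn ℝ ∞ s₃ U) :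
    ContDiffOn ℝ ∞ (jacobian s₁ s₂ s₃) U :=
  (h₁.fderiv_of_isOpen hU (m := ∞) (by simp)).clm_apply (contDiffOn_crossCovectors hU h₂ h₃)

/-- A Morse singularity on the level line is a simple zero of the Jacobian, transversally to
the level line. -/
theorem jacobian_of_morse (hU : IsOpen U) (h0 : 0 ∈ U) (h₁ : ContDiffOn ℝ ∞ s₁ U)
    (h₂ : ContDiffOn ℝ ∞ s₂ U) (h₃ : ContDiffOn ℝ ∞ s₃ U)
    (hind : LinearIndependent ℝ ![fderiv ℝ s₂ 0, fderiv ℝ s₃ 0])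
    (hM : HasMorseSingularityOnLevelLine s₁ s₂ s₃ 0) :
    jacobian s₁ s₂ s₃ 0 = 0 ∧ ∀ w, fderiv ℝ (jacobian s₁ s₂ s₃) 0 w = 0 →
      fderiv ℝ s₂ 0 w = 0 → fderiv ℝ s₃ 0 w = 0 → w = 0 := by
  obtain ⟨δ, γ, hδ, hγ, hγ0, hγ', hlev, hcrit, hnd⟩ := hM
  have hI : IsOpen (Ioo (-δ) δ) := isOpen_Ioo
  have h0I : (0 : ℝ) ∈ Ioo (-δ) δ := ⟨by linarith, hδ⟩
  have hdiff : ∀ {E : Type} [NormedAddCommGroup E] [NormedSpace ℝ E] {g : Coord 3 → E},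
      ContDiffOn ℝ ∞ g U → ∀ p ∈ U, DifferentiableAt ℝ g p := fun hg p hp =>
    ((hg p hp).contDiffAt (hU.mem_nhds hp)).differentiableAt (by simp)
  have hγd : ∀ t ∈ Ioo (-δ) δ, HasDerivAt γ (deriv γ t) t := fun t ht =>
    (((hγ t ht).contDiffAt (hI.mem_nhds ht)).differentiableAt (by simp)).hasDerivAt
  have hγ'd : DifferentiableAt ℝ (deriv γ) 0 := by
    have h : ContDiffOn ℝ 1 (deriv γ) (Ioo (-δ) δ) :=
      hγ.deriv_of_isOpen hI (WithTop.coe_le_coe.2 le_top)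
    exact ((h 0 h0I).contDiffAt (hI.mem_nhds h0I)).differentiableAt (by simp)
  have hUI : ∀ᶠ t in 𝓝 (0 : ℝ), t ∈ Ioo (-δ) δ ∧ γ t ∈ U := by
    refine (hI.eventually_mem h0I).and ((hγd 0 h0I).continuousAt.eventually_mem ?_)
    rw [hγ0]; exact hU.mem_nhds h0
  let N : Coord 3 → Coord 3 := fun p => crossCovectors (fderiv ℝ s₂ p) (fderiv ℝ s₃ p)
  have hN := contDiffOn_crossCovectors hU h₂ h₃
  let A : ℝ → ℝ := fun t => N (γ t) ⬝ᵥ N (γ t)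
  let B : ℝ → ℝ := fun t => N (γ t) ⬝ᵥ deriv γ t
  have htan : ∀ t ∈ Ioo (-δ) δ, γ t ∈ U →
      fderiv ℝ s₂ (γ t) (deriv γ t) = 0 ∧ fderiv ℝ s₃ (γ t) (deriv γ t) = 0 := by
    intro t ht hγt
    constructor
    · have d := (hdiff h₂ _ hγt).hasFDerivAt.comp_hasDerivAt t (hγd t ht)
      have hc : s₂ ∘ γ =ᶠ[𝓝 t] fun _ => s₂ 0 := by
        filter_upwards [hI.mem_nhds ht] with x hx using (hlev x hx).1
      exact d.unique ((hasDerivAt_const t _).congr_of_eventuallyEq hc)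
    · have d := (hdiff h₃ _ hγt).hasFDerivAt.comp_hasDerivAt t (hγd t ht)
      have hc : s₃ ∘ γ =ᶠ[𝓝 t] fun _ => s₃ 0 := by
        filter_upwards [hI.mem_nhds ht] with x hx using (hlev x hx).2
      exact d.unique ((hasDerivAt_const t _).congr_of_eventuallyEq hc)
  -- The velocity of the level curve is proportional to `N`, so the derivative of `s₁` along the
  -- curve is `u` up to the factor `B / A`.
  have hpar : ∀ t ∈ Ioo (-δ) δ, γ t ∈ U → A t • deriv γ t = B t • N (γ t) := fun t ht hγt =>
    smul_eq_of_mem_ker (htan t ht hγt).1 (htan t ht hγt).2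
  have hγU : γ 0 ∈ U := by rw [hγ0]; exact h0
  have hder : ∀ t ∈ Ioo (-δ) δ, γ t ∈ U →
      A t * deriv (fun t => s₁ (γ t)) t = B t * jacobian s₁ s₂ s₃ (γ t) := by
    intro t ht hγt
    have d := (hdiff h₁ _ hγt).hasFDerivAt.comp_hasDerivAt t (hγd t ht)
    have e := congrArg (fderiv ℝ s₁ (γ t)) (hpar t ht hγt)
    rw [map_smul, map_smul] at e
    rw [show deriv (fun t => s₁ (γ t)) t = _ from d.deriv]
    exact e
  have hN0 : N (γ 0) ≠ 0 := by
    rw [hγ0]; exact crossCovectors_ne_zero hind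
  have hA0 : A 0 ≠ 0 := fun h => hN0 (dotProduct_self_eq_zero.1 h)
  have hB0 : B 0 ≠ 0 := by
    intro h
    have e := hpar 0 h0I hγU
    rw [h, zero_smul] at e
    exact (smul_ne_zero hA0 hγ') e
  have hu0 : jacobian s₁ s₂ s₃ 0 = 0 := by
    have e := hder 0 h0I hγU
    rw [hcrit, mul_zero, hγ0] at e
    exact (mul_eq_zero.1 e.symm).resolve_left hB0
  have hju := hdiff (contDiffOn_jacobian hU h₁ h₂ h₃) _ h0
  have hNγ : DifferentiableAt ℝ (fun t => N (γ t)) 0 :=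
    (hdiff hN _ hγU).comp 0 (hγd 0 h0I).differentiableAt
  have hdot : ∀ {a b : ℝ → Coord 3}, DifferentiableAt ℝ a 0 → DifferentiableAt ℝ b 0 →
      DifferentiableAt ℝ (fun t => a t ⬝ᵥ b t) 0 := by
    intro a b ha hb
    simp only [dotProduct]
    have ha' := differentiableAt_pi.1 ha
    have hb' := differentiableAt_pi.1 hb
    exact DifferentiableAt.fun_sum fun i _ => (ha' i).mul (hb' i)
  have hAd : HasDerivAt A (deriv A 0) 0 := (hdot hNγ hNγ).hasDerivAt
  have hBd : HasDerivAt B (deriv B 0) 0 := (hdot hNγ hγ'd).hasDerivAt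
  -- A nonzero `deriv` certifies differentiability, since `deriv` defaults to zero elsewhere.
  have hhd := (differentiableAt_of_deriv_ne_zero hnd).hasDerivAt
  have hud : HasDerivAt (fun t => jacobian s₁ s₂ s₃ (γ t))
      (fderiv ℝ (jacobian s₁ s₂ s₃) 0 (deriv γ 0)) 0 := by
    have hju' : HasFDerivAt (jacobian s₁ s₂ s₃) (fderiv ℝ (jacobian s₁ s₂ s₃) 0) (γ 0) := by
      rw [hγ0]; exact hju.hasFDerivAt
    exact hju'.comp_hasDerivAt 0 (hγd 0 h0I)
  have heq : (fun t => A t * deriv (fun t => s₁ (γ t)) t) =ᶠ[𝓝 0]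
      fun t => B t * jacobian s₁ s₂ s₃ (γ t) := by
    filter_upwards [hUI] with t ht using hder t ht.1 ht.2
  -- Both `(s₁ ∘ γ)'` and `u ∘ γ` vanish at `0`, so the derivatives of `A` and `B` drop out and `A
  -- (s₁ ∘ γ)'' = B du(γ')` remains.
  have hd := (hAd.fun_mul hhd).unique ((hBd.fun_mul hud).congr_of_eventuallyEq heq)
  rw [hcrit, hγ0, hu0, mul_zero, mul_zero, zero_add, zero_add] at hd
  have hduγ : fderiv ℝ (jacobian s₁ s₂ s₃) 0 (deriv γ 0) ≠ 0 := by
    intro h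
    rw [h, mul_zero] at hd
    exact (mul_ne_zero hA0 hnd) hd
  refine ⟨hu0, fun w hw hw2 hw3 => ?_⟩
  have e1 := congrArg (fderiv ℝ (jacobian s₁ s₂ s₃) 0) (hpar 0 h0I hγU)
  rw [map_smul, map_smul, smul_eq_mul, smul_eq_mul] at e1
  have hduN : fderiv ℝ (jacobian s₁ s₂ s₃) 0 (N (γ 0)) ≠ 0 := by
    intro h
    rw [h, mul_zero] at e1
    exact (mul_ne_zero hA0 hduγ) e1
  have e2 := smul_eq_of_mem_ker hw2 hw3
  have e3 := congrArg (fderiv ℝ (jacobian s₁ s₂ s₃) 0) e2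
  rw [map_smul, map_smul, smul_eq_mul, smul_eq_mul, hw, mul_zero] at e3
  simp only [A, N, hγ0] at hA0 hduN
  have e4 := (mul_eq_zero.1 e3.symm).resolve_right hduN
  rw [e4, zero_smul] at e2
  exact (smul_eq_zero.1 e2).resolve_left hA0

end

/-! ### Derivatives of smooth coordinate changes. -/

section

variable {n : ℕ} {φ : OpenPartialHomeomorph (Coord n) (Coord n)}

theorem IsSmoothChange.hasFDerivAt (hφ : IsSmoothChange φ) {p : Coord n} (hp : p ∈ φ.source) :
    HasFDerivAt φ (fderiv ℝ φ p) p :=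
  (((hφ.smooth p hp).contDiffAt (φ.open_source.mem_nhds hp)).differentiableAt
    (by simp)).hasFDerivAt

theorem IsSmoothChange.hasFDerivAt_symm (hφ : IsSmoothChange φ) {q : Coord n}
    (hq : q ∈ φ.target) : HasFDerivAt φ.symm (fderiv ℝ φ.symm q) q :=
  (((hφ.smooth_symm q hq).contDiffAt (φ.open_target.mem_nhds hq)).differentiableAt
    (by simp)).hasFDerivAt

theorem IsSmoothChange.fderiv_fderiv_symm (hφ : IsSmoothChange φ) {q : Coord n}
    (hq : q ∈ φ.target) (w : Coord n) : fderiv ℝ φ (φ.symm q) (fderiv ℝ φ.symm q w) = w := by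
  have h := (hφ.hasFDerivAt (φ.map_target hq)).comp q (hφ.hasFDerivAt_symm hq)
  have he : φ ∘ φ.symm =ᶠ[𝓝 q] id := by
    filter_upwards [φ.open_target.mem_nhds hq] with x hx using φ.right_inv hx
  exact DFunLike.congr_fun (h.unique ((hasFDerivAt_id q).congr_of_eventuallyEq he)) w

theorem IsSmoothChange.fderiv_component (hφ : IsSmoothChange φ) {p : Coord n}
    (hp : p ∈ φ.source) (i : Fin n) (w : Coord n) :
    fderiv ℝ (fun p => φ p i) p w = fderiv ℝ φ p w i := by
  rw [(hasFDerivAt_pi'.1 (hφ.hasFDerivAt hp) i).fderiv]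
  rfl

end

/-! ### Construction of the coordinates. -/

section

variable {U : Set (Coord 3)} {s₁ s₂ s₃ : Coord 3 → ℝ}

theorem fderiv_vec_apply {a b c : Coord 3 → ℝ} {p : Coord 3} (ha : DifferentiableAt ℝ a p)
    (hb : DifferentiableAt ℝ b p) (hc : DifferentiableAt ℝ c p) (w : Coord 3) :
    fderiv ℝ (fun p => ![a p, b p, c p]) p w
      = ![fderiv ℝ a p w, fderiv ℝ b p w, fderiv ℝ c p w] := by
  have h : HasFDerivAt (fun p => ![a p, b p, c p])
      (ContinuousLinearMap.pi ![fderiv ℝ a p, fderiv ℝ b p, fderiv ℝ c p]) p := by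
    refine hasFDerivAt_pi.2 fun i => ?_
    fin_cases i
    · exact ha.hasFDerivAt
    · exact hb.hasFDerivAt
    · exact hc.hasFDerivAt
  rw [h.fderiv]
  ext i
  fin_cases i <;> rfl

theorem contDiffOn_vec {a b c : Coord 3 → ℝ} (ha : ContDiffOn ℝ ∞ a U)
    (hb : ContDiffOn ℝ ∞ b U) (hc : ContDiffOn ℝ ∞ c U) :
    ContDiffOn ℝ ∞ (fun p => ![a p, b p, c p]) U := by
  refine contDiffOn_pi.2 fun i => ?_
  fin_cases i
  · exact ha
  · exact hb
  · exact hc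

/-- Coordinates in which `s₁` is `± x²` plus an affine function of `s₂` and `s₃`, for functions
that satisfy the relations between the invariants of a Nijenhuis operator `L`. -/
theorem exists_morse_coordinates {L : OpField 3} (hU : IsOpen U) (h0 : 0 ∈ U)
    (h₁ : ContDiffOn ℝ ∞ s₁ U) (h₂ : ContDiffOn ℝ ∞ s₂ U) (h₃ : ContDiffOn ℝ ∞ s₃ U)
    (hL₁ : ∀ p ∈ U, ∀ v, fderiv ℝ s₁ p (L p v) = fderiv ℝ s₂ p v - s₁ p * fderiv ℝ s₁ p v)
    (hL₂ : ∀ p ∈ U, ∀ v, fderiv ℝ s₂ p (L p v) = fderiv ℝ s₃ p v - s₂ p * fderiv ℝ s₁ p v)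
    (hL₃ : ∀ p ∈ U, ∀ v, fderiv ℝ s₃ p (L p v) = -s₃ p * fderiv ℝ s₁ p v)
    (hind : LinearIndependent ℝ ![fderiv ℝ s₂ 0, fderiv ℝ s₃ 0])
    (hs₂ : s₂ 0 = 0) (hs₃ : s₃ 0 = 0) (hM : HasMorseSingularityOnLevelLine s₁ s₂ s₃ 0) :
    s₁ 0 ≠ 0 ∧ ∃ ε : ℝ, (ε = 1 ∨ ε = -1) ∧
      ∃ φ : OpenPartialHomeomorph (Coord 3) (Coord 3), IsSmoothChange φ ∧ 0 ∈ φ.source ∧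
        φ.source ⊆ U ∧ φ 0 = 0 ∧ ∀ p ∈ φ.source, φ p 1 = s₂ p ∧ φ p 2 = s₃ p ∧
          s₁ p = ε * φ p 0 ^ 2 + s₂ p / s₁ 0 - s₃ p / s₁ 0 ^ 2 + s₁ 0 := by
  obtain ⟨hu0, hker⟩ := jacobian_of_morse hU h0 h₁ h₂ h₃ hind hM
  have hu := contDiffOn_jacobian hU h₁ h₂ h₃
  set u := jacobian s₁ s₂ s₃
  have hdiff : ∀ {g : Coord 3 → ℝ}, ContDiffOn ℝ ∞ g U → ∀ p ∈ U, DifferentiableAt ℝ g p :=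
    fun hg p hp => ((hg p hp).contDiffAt (hU.mem_nhds hp)).differentiableAt (by simp)
  -- The Jacobian is the third coordinate because its zero set is exactly where `ds₁` is a
  -- combination of `ds₂` and `ds₃` near `0`.
  let Φ : Coord 3 → Coord 3 := fun p => ![u p, s₂ p, s₃ p]
  have hΦ : ContDiffOn ℝ ∞ Φ U := contDiffOn_vec hu h₂ h₃
  have hΦ0 : Φ 0 = 0 := by
    ext i; fin_cases i <;> simp [Φ, hu0, hs₂, hs₃]
  have hΦd : ∀ p ∈ U, ∀ w, fderiv ℝ Φ p w = ![fderiv ℝ u p w, fderiv ℝ s₂ p w, fderiv ℝ s₃ p w] :=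
    fun p hp w => fderiv_vec_apply (hdiff hu p hp) (hdiff h₂ p hp) (hdiff h₃ p hp) w
  have hinj : ∀ w, fderiv ℝ Φ 0 w = 0 → w = 0 := by
    intro w hw
    rw [hΦd 0 h0] at hw
    exact hker w (congrFun hw 0) (congrFun hw 1) (congrFun hw 2)
  have hJ := contDiffOn_jacobian hU hu h₂ h₃
  set J := jacobian u s₂ s₃
  have hJ0 : J 0 ≠ 0 := by
    intro h
    refine crossCovectors_ne_zero hind (hker _ h (apply_crossCovectors_left _ _)
      (apply_crossCovectors_right _ _))
  have hJne : ∀ᶠ p in 𝓝 (0 : Coord 3), J p ≠ 0 :=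
    (hdiff hJ 0 h0).continuousAt.eventually_ne hJ0
  obtain ⟨φ, hφ, hφΦ, hφ0, hsrc, r, hr, hball⟩ :=
    exists_isSmoothChange hU h0 hΦ hΦ0 hinj hJne
  have hsU : ∀ p ∈ φ.source, p ∈ U := fun p hp => (hsrc hp).1
  have hmaps : MapsTo φ.symm (Metric.ball 0 r) U := fun q hq =>
    hsU _ (φ.map_target (hball ▸ hq))
  have hsymm : ContDiffOn ℝ ∞ φ.symm (Metric.ball 0 r) := hball ▸ hφ.smooth_symm
  have hsymm0 : φ.symm 0 = 0 := by
    have h := φ.left_inv hφ0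
    rwa [hφΦ, hΦ0] at h
  let f : Coord 3 → ℝ := s₁ ∘ φ.symm
  have hf : ContDiffOn ℝ ∞ f (Metric.ball 0 r) := h₁.comp hsymm hmaps
  have hf0 : f 0 = s₁ 0 := congrArg s₁ hsymm0
  have hfd : ∀ q ∈ Metric.ball (0 : Coord 3) r, DifferentiableAt ℝ f q := fun q hq =>
    ((hf q hq).contDiffAt (Metric.isOpen_ball.mem_nhds hq)).differentiableAt (by simp)
  have hchain : ∀ q ∈ Metric.ball (0 : Coord 3) r, ∀ v,
      fderiv ℝ s₁ (φ.symm q) v = fderiv ℝ u (φ.symm q) v * fderiv ℝ f q (Pi.single 0 1)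
        + fderiv ℝ s₂ (φ.symm q) v * fderiv ℝ f q (Pi.single 1 1)
        + fderiv ℝ s₃ (φ.symm q) v * fderiv ℝ f q (Pi.single 2 1) := by
    intro q hq v
    have hqt : q ∈ φ.target := hball ▸ hq
    have hp := φ.map_target hqt
    have hfd' : HasFDerivAt f (fderiv ℝ f q) (φ (φ.symm q)) := by
      rw [φ.right_inv hqt]; exact (hfd q hq).hasFDerivAt
    have hcomp := hfd'.comp (φ.symm q) (hφ.hasFDerivAt hp)
    have heq : s₁ =ᶠ[𝓝 (φ.symm q)] f ∘ φ := by
      filter_upwards [φ.open_source.mem_nhds hp] with x hx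
      change s₁ x = s₁ (φ.symm (φ x))
      rw [φ.left_inv hx]
    rw [(hcomp.congr_of_eventuallyEq heq).fderiv, ContinuousLinearMap.comp_apply, hφΦ,
      hΦd _ (hsU _ hp), covector_apply]
    rfl
  have hcoord : ∀ q ∈ Metric.ball (0 : Coord 3) r,
      u (φ.symm q) = q 0 ∧ s₂ (φ.symm q) = q 1 ∧ s₃ (φ.symm q) = q 2 := by
    intro q hq
    have h := φ.right_inv (hball ▸ hq : q ∈ φ.target)
    rw [hφΦ] at h
    exact ⟨congrFun h 0, congrFun h 1, congrFun h 2⟩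
  have hJq : ∀ q ∈ Metric.ball (0 : Coord 3) r, J (φ.symm q) ≠ 0 := fun q hq =>
    (hsrc (φ.map_target (hball ▸ hq : q ∈ φ.target))).2
  let k : Coord 3 → ℝ := fun q => (J (φ.symm q))⁻¹
  have hk : ContDiffOn ℝ ∞ k (Metric.ball 0 r) := (hJ.comp hsymm hmaps).inv hJq
  -- Evaluate the chain rule on `N`, which `ds₂` and `ds₃` kill: `ds₁(N) = u` and `du(N) = J`, so
  -- the derivative along the first coordinate is `u / J`.
  have hfk : ∀ q ∈ Metric.ball (0 : Coord 3) r, fderiv ℝ f q (Pi.single 0 1) = q 0 * k q := by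
    intro q hq
    have h := hchain q hq (crossCovectors (fderiv ℝ s₂ (φ.symm q)) (fderiv ℝ s₃ (φ.symm q)))
    rw [apply_crossCovectors_left, apply_crossCovectors_right, zero_mul, zero_mul, add_zero,
      add_zero] at h
    change u (φ.symm q) = J (φ.symm q) * _ at h
    rw [(hcoord q hq).1] at h
    rw [h]
    have := hJq q hq
    simp only [k]
    field_simp
  obtain ⟨ε, hε, X, V, hV, hV0, hVr, hX, hX0, hXker, hXsq⟩ :=
    exists_square_decomposition hr hfd hk hfk (inv_ne_zero (hJq 0 (Metric.mem_ball_self hr)))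
  -- On `u = 0` one has `ds₁ = P ds₂ + Q ds₃`. Computing `ds₁(Lv)` directly and through this
  -- expression, for `ds₂(v) = a` and `ds₃(v) = b`, gives the identity; `du(v)` does not enter and
  -- is set to `0`.
  have hsys : ∀ q ∈ Metric.ball (0 : Coord 3) r, q 0 = 0 → ∀ a b : ℝ,
      a - fderiv ℝ f q (Pi.single 1 1) * b
        = (f q - (q 1 * fderiv ℝ f q (Pi.single 1 1) + q 2 * fderiv ℝ f q (Pi.single 2 1)))
          * (a * fderiv ℝ f q (Pi.single 1 1) + b * fderiv ℝ f q (Pi.single 2 1)) := by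
    intro q hq hq0 a b
    have hqt : q ∈ φ.target := hball ▸ hq
    have hp := hsU _ (φ.map_target hqt)
    let v := fderiv ℝ φ.symm q ![0, a, b]
    have hv := hφ.fderiv_fderiv_symm hqt ![0, a, b]
    rw [hφΦ, hΦd _ hp] at hv
    have hv1 : fderiv ℝ s₂ (φ.symm q) v = a := congrFun hv 1
    have hv2 : fderiv ℝ s₃ (φ.symm q) v = b := congrFun hv 2
    have e1 := hchain q hq (L (φ.symm q) v)
    have e2 := hchain q hq v
    rw [hfk q hq, hq0, zero_mul, mul_zero, zero_add] at e1 e2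
    rw [hL₁ _ hp, hL₂ _ hp, hL₃ _ hp, hv1, hv2, (hcoord q hq).2.1, (hcoord q hq).2.2] at e1
    rw [hv1, hv2] at e2
    change a - f q * _ = _ at e1
    rw [e2] at e1
    linear_combination e1
  obtain ⟨hc, r', hr', haff⟩ := eq_affine_of_clairaut hr hf
    (fun q hq hq0 => by have := hsys q hq hq0 1 0; linarith)
    (fun q hq hq0 => by have := hsys q hq hq0 0 1; linarith)
  rw [hf0] at hc haff
  refine ⟨hc, ε, hε, ?_⟩
  let W : Set (Coord 3) := φ.source ∩ φ ⁻¹' V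
  have hW : IsOpen W := φ.isOpen_inter_preimage hV
  have hφ00 : φ 0 = 0 := by rw [hφΦ]; exact hΦ0
  have hW0 : 0 ∈ W := ⟨hφ0, by rw [mem_preimage, hφ00]; exact hV0⟩
  have hWU : W ⊆ U := fun p hp => hsU p hp.1
  have hXφ : ContDiffOn ℝ ∞ (X ∘ φ) W :=
    hX.comp (hφ.smooth.mono inter_subset_left) fun p hp => hp.2
  -- The final coordinates: `u` is replaced by the square-root coordinate `X`, whose differential at
  -- `0` is a nonzero multiple of that of `u`.
  let Ψ : Coord 3 → Coord 3 := fun p => ![(X ∘ φ) p, s₂ p, s₃ p]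
  have hΨ : ContDiffOn ℝ ∞ Ψ W := contDiffOn_vec hXφ (h₂.mono hWU) (h₃.mono hWU)
  have hΨ0 : Ψ 0 = 0 := by
    ext i; fin_cases i <;> simp [Ψ, hφ00, hX0, hs₂, hs₃]
  have hXφd : HasFDerivAt (X ∘ φ) ((fderiv ℝ X 0).comp (fderiv ℝ φ 0)) 0 := by
    have hXd : HasFDerivAt X (fderiv ℝ X 0) (φ 0) := by
      rw [hφ00]
      exact (((hX 0 hV0).contDiffAt (hV.mem_nhds hV0)).differentiableAt (by simp)).hasFDerivAt
    exact hXd.comp 0 (hφ.hasFDerivAt hφ0)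
  have hΨinj : ∀ w, fderiv ℝ Ψ 0 w = 0 → w = 0 := by
    intro w hw
    rw [fderiv_vec_apply hXφd.differentiableAt (hdiff h₂ 0 h0) (hdiff h₃ 0 h0), hXφd.fderiv] at hw
    have h : fderiv ℝ φ 0 w 0 = 0 := hXker _ (congrFun hw 0)
    rw [hφΦ, hΦd 0 h0] at h
    exact hker w h (congrFun hw 1) (congrFun hw 2)
  have hnear : φ ⁻¹' Metric.ball 0 r' ∈ 𝓝 (0 : Coord 3) := by
    refine (hφ.hasFDerivAt hφ0).continuousAt.preimage_mem_nhds ?_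
    rw [hφ00]; exact Metric.ball_mem_nhds 0 hr'
  obtain ⟨ψ, hψ, hψΨ, hψ0, hψs, -⟩ := exists_isSmoothChange hW hW0 hΨ hΨ0 hΨinj hnear
  refine ⟨ψ, hψ, hψ0, fun p hp => hWU (hψs hp).1, by rw [hψΨ]; exact hΨ0, fun p hp => ?_⟩
  have hp' := hψs hp
  rw [hψΨ]
  refine ⟨rfl, rfl, ?_⟩
  have e1 := hXsq (φ p) hp'.1.2
  rw [haff (φ p) hp'.2] at e1
  have e2 : f (φ p) = s₁ p := congrArg s₁ (φ.left_inv hp'.1.1)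
  rw [e2] at e1
  have e3 : φ p 1 = s₂ p := by rw [hφΦ]; rfl
  have e4 : φ p 2 = s₃ p := by rw [hφΦ]; rfl
  rw [e3, e4] at e1
  change s₁ p = ε * X (φ p) ^ 2 + _ - _ + _
  linarith

end

/-! ### The normal form of the matrix. -/

theorem matrixInCoords_apply {n : ℕ} (L : OpField n)
    (φ : OpenPartialHomeomorph (Coord n) (Coord n)) (q : Coord n) (i j : Fin n) :
    matrixInCoords L φ q i j = fderiv ℝ φ (φ.symm q)
      (L (φ.symm q) (fderiv ℝ φ.symm q (Pi.single j 1))) i := by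
  rw [matrixInCoords, LinearMap.toMatrix'_apply]
  rfl

/-- Extends to `x = 0` the formula for the first row, which the relations give only after division
by `x`. -/
theorem continuousOn_matrixInCoords {n : ℕ} {L : OpField n} {U : Set (Coord n)}
    (hL : ContDiffOn ℝ ∞ L U) {φ : OpenPartialHomeomorph (Coord n) (Coord n)}
    (hφ : IsSmoothChange φ) (hsU : φ.source ⊆ U) (i j : Fin n) :
    ContinuousOn (fun q => matrixInCoords L φ q i j) φ.target := by
  simp only [matrixInCoords_apply]
  have hm : MapsTo φ.symm φ.target φ.source := fun q hq => φ.map_target hq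
  have h1 : ContinuousOn (fun q => fderiv ℝ φ (φ.symm q)) φ.target :=
    (hφ.smooth.continuousOn_fderiv_of_isOpen φ.open_source (by simp)).comp
      φ.continuousOn_symm hm
  have h2 : ContinuousOn (fun q => L (φ.symm q)) φ.target :=
    (hL.continuousOn.mono hsU).comp φ.continuousOn_symm hm
  have h3 : ContinuousOn (fun q => fderiv ℝ φ.symm q) φ.target :=
    hφ.smooth_symm.continuousOn_fderiv_of_isOpen φ.open_target (by simp)
  exact continuousOn_pi.1 (h1.clm_apply (h2.clm_apply (h3.clm_apply continuousOn_const))) i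

/-- In coordinates `(x, σ₂, σ₃)` with `σ₁ = ± x² + σ₂ / c - σ₃ / c² + c`, the matrix of a
Nijenhuis operator takes the normal form. -/
theorem matrixInCoords_eq_normalForm {L : OpField 3} {U : Set (Coord 3)} {s₁ s₂ s₃ : Coord 3 → ℝ}
    (hL : ContDiffOn ℝ ∞ L U)
    (hL₁ : ∀ p ∈ U, ∀ v, fderiv ℝ s₁ p (L p v) = fderiv ℝ s₂ p v - s₁ p * fderiv ℝ s₁ p v)
    (hL₂ : ∀ p ∈ U, ∀ v, fderiv ℝ s₂ p (L p v) = fderiv ℝ s₃ p v - s₂ p * fderiv ℝ s₁ p v)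
    (hL₃ : ∀ p ∈ U, ∀ v, fderiv ℝ s₃ p (L p v) = -s₃ p * fderiv ℝ s₁ p v)
    {c ε : ℝ} (hc : c ≠ 0) (hε : ε ≠ 0)
    {φ : OpenPartialHomeomorph (Coord 3) (Coord 3)} (hφ : IsSmoothChange φ)
    (hsU : φ.source ⊆ U)
    (hs : ∀ p ∈ φ.source, φ p 1 = s₂ p ∧ φ p 2 = s₃ p ∧
      s₁ p = ε * φ p 0 ^ 2 + s₂ p / c - s₃ p / c ^ 2 + c)
    {x y z : ℝ} (hq : ![x, y, z] ∈ φ.target) :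
    matrixInCoords L φ ![x, y, z] =
      !![-ε * x ^ 2 - c, -(x / (2 * c)), x / (2 * c ^ 2);
         -ε * (2 * x * y), -(y / c), y / c ^ 2 + 1;
         -ε * (2 * x * z), -(z / c), z / c ^ 2] := by
  have hd₂ : ∀ p ∈ φ.source, ∀ w, fderiv ℝ s₂ p w = fderiv ℝ φ p w 1 := by
    intro p hp w
    rw [← hφ.fderiv_component hp]
    refine DFunLike.congr_fun (EventuallyEq.fderiv_eq ?_) w
    filter_upwards [φ.open_source.mem_nhds hp] with x hx using (hs x hx).1.symm
  have hd₃ : ∀ p ∈ φ.source, ∀ w, fderiv ℝ s₃ p w = fderiv ℝ φ p w 2 := by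
    intro p hp w
    rw [← hφ.fderiv_component hp]
    refine DFunLike.congr_fun (EventuallyEq.fderiv_eq ?_) w
    filter_upwards [φ.open_source.mem_nhds hp] with x hx using (hs x hx).2.1.symm
  have hd₁ : ∀ p ∈ φ.source, ∀ w, fderiv ℝ s₁ p w = 2 * ε * φ p 0 * fderiv ℝ φ p w 0
      + fderiv ℝ φ p w 1 / c - fderiv ℝ φ p w 2 / c ^ 2 := by
    intro p hp w
    have h := hasFDerivAt_pi'.1 (hφ.hasFDerivAt hp)
    have hsum := (((((h 0).pow 2).const_mul ε).add ((h 1).mul_const c⁻¹)).sub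
      ((h 2).mul_const (c ^ 2)⁻¹)).add_const c
    have heq : s₁ =ᶠ[𝓝 p] fun p => ε * φ p 0 ^ 2 + φ p 1 * c⁻¹ - φ p 2 * (c ^ 2)⁻¹ + c := by
      filter_upwards [φ.open_source.mem_nhds hp] with x hx
      obtain ⟨e1, e2, e3⟩ := hs x hx
      rw [← e1, ← e2, div_eq_mul_inv, div_eq_mul_inv] at e3
      exact e3
    rw [(hsum.congr_of_eventuallyEq heq).fderiv]
    simp
    ring
  -- The relations for `s₂` and `s₃` are the last two rows. The one for `s₁` gives the first row
  -- only up to the factor `2 ε x`, the coefficient of `dx` in `ds₁`.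
  have hmain : ∀ q ∈ φ.target, ∀ j : Fin 3,
      matrixInCoords L φ q 1 j = (Pi.single j 1 : Coord 3) 2
        - q 1 * (2 * ε * q 0 * (Pi.single j 1 : Coord 3) 0 + (Pi.single j 1 : Coord 3) 1 / c
          - (Pi.single j 1 : Coord 3) 2 / c ^ 2) ∧
      matrixInCoords L φ q 2 j =
        - q 2 * (2 * ε * q 0 * (Pi.single j 1 : Coord 3) 0 + (Pi.single j 1 : Coord 3) 1 / c
          - (Pi.single j 1 : Coord 3) 2 / c ^ 2) ∧
      2 * ε * q 0 * matrixInCoords L φ q 0 j = 2 * ε * q 0 *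
        ((-ε * q 0 ^ 2 - c) * (Pi.single j 1 : Coord 3) 0
          - q 0 / 2 * ((Pi.single j 1 : Coord 3) 1 / c - (Pi.single j 1 : Coord 3) 2 / c ^ 2)) := by
    intro q hq j
    have hp := φ.map_target hq
    have hv := hφ.fderiv_fderiv_symm hq (Pi.single j 1)
    set p := φ.symm q
    set v := fderiv ℝ φ.symm q (Pi.single j 1)
    have hpq : φ p = q := φ.right_inv hq
    obtain ⟨e2, e3, e1⟩ := hs p hp
    have l1 := hL₁ p (hsU hp) v
    have l2 := hL₂ p (hsU hp) v
    have l3 := hL₃ p (hsU hp) v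
    rw [hd₁ p hp, hd₁ p hp, hd₂ p hp, hv, e1, ← e2, ← e3, hpq] at l1
    rw [hd₁ p hp, hd₂ p hp, hd₃ p hp, hv, ← e2, hpq] at l2
    rw [hd₁ p hp, hd₃ p hp, hv, ← e3, hpq] at l3
    simp only [matrixInCoords_apply]
    refine ⟨l2, l3, ?_⟩
    rw [l2, l3] at l1
    have hcc : c * c⁻¹ = 1 := mul_inv_cancel₀ hc
    linear_combination l1
      - ((Pi.single j 1 : Coord 3) 1 - (Pi.single j 1 : Coord 3) 2 * c⁻¹) * hcc
  -- Cancel `2 ε t` for `t ≠ 0` on the line through the point parallel to the first axis, then let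
  -- `t → x`; this covers `x = 0`.
  have hrow : ∀ j : Fin 3, matrixInCoords L φ ![x, y, z] 0 j =
      (-ε * x ^ 2 - c) * (Pi.single j 1 : Coord 3) 0
        - x / 2 * ((Pi.single j 1 : Coord 3) 1 / c - (Pi.single j 1 : Coord 3) 2 / c ^ 2) := by
    intro j
    let ℓ : ℝ → Coord 3 := fun t => ![t, y, z]
    have hℓ : Continuous ℓ := by
      refine continuous_pi fun i => ?_
      fin_cases i
      · exact continuous_id
      · exact continuous_const
      · exact continuous_const
    have hℓt : ∀ᶠ t in 𝓝 x, ℓ t ∈ φ.target :=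
      hℓ.continuousAt.eventually_mem (φ.open_target.mem_nhds hq)
    have hc1 : ContinuousAt (fun t => matrixInCoords L φ (ℓ t) 0 j) x :=
      ContinuousAt.comp (f := ℓ) (g := fun q => matrixInCoords L φ q 0 j)
        ((continuousOn_matrixInCoords hL hφ hsU 0 j).continuousAt (φ.open_target.mem_nhds hq))
        hℓ.continuousAt
    have hc2 : ContinuousAt (fun t : ℝ => (-ε * t ^ 2 - c) * (Pi.single j 1 : Coord 3) 0
        - t / 2 * ((Pi.single j 1 : Coord 3) 1 / c - (Pi.single j 1 : Coord 3) 2 / c ^ 2)) x := by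
      fun_prop
    have hne : ∀ᶠ t in 𝓝[≠] x, t ≠ 0 := by
      by_cases hx : x = 0
      · rw [hx]; exact self_mem_nhdsWithin
      · exact nhdsWithin_le_nhds (isOpen_ne.eventually_mem hx)
    refine tendsto_nhds_unique_of_eventuallyEq (hc1.tendsto.mono_left nhdsWithin_le_nhds)
      (hc2.tendsto.mono_left (nhdsWithin_le_nhds (s := {x}ᶜ))) ?_
    filter_upwards [hne, nhdsWithin_le_nhds hℓt] with t ht htt
    have h := (hmain (ℓ t) htt j).2.2
    change 2 * ε * t * _ = 2 * ε * t * _ at h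
    exact mul_left_cancel₀ (by simp [hε, ht]) h
  ext i j
  fin_cases i
  · rw [show (⟨0, by decide⟩ : Fin 3) = 0 from rfl, hrow j]
    fin_cases j <;> simp <;> field_simp
  · rw [show (⟨1, by decide⟩ : Fin 3) = 1 from rfl, (hmain _ hq j).1]
    fin_cases j <;> simp <;> ring
  · rw [show (⟨2, by decide⟩ : Fin 3) = 2 from rfl, (hmain _ hq j).2.1]
    fin_cases j <;> simp <;> ring

end NijenhuisGeometry

/-! ### The normal form theorem. -/

theorem theorem3 (U : Set (NijenhuisGeometry.Coord 3)) (hU : IsOpen U)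
    (h0 : (0 : NijenhuisGeometry.Coord 3) ∈ U)
    (L : NijenhuisGeometry.OpField 3) (hL : NijenhuisGeometry.IsNijenhuisOn L U)
    (hind : ∀ᶠ p in 𝓝 (0 : NijenhuisGeometry.Coord 3),
      LinearIndependent ℝ ![fderiv ℝ (NijenhuisGeometry.sigma L 2) p,
        fderiv ℝ (NijenhuisGeometry.sigma L 3) p])
    (h2 : NijenhuisGeometry.sigma L 2 0 = 0) (h3 : NijenhuisGeometry.sigma L 3 0 = 0)
    (hMorse : NijenhuisGeometry.HasMorseSingularityOnLevelLine (NijenhuisGeometry.sigma L 1)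
      (NijenhuisGeometry.sigma L 2) (NijenhuisGeometry.sigma L 3) 0)
    (c : ℝ) (hc : NijenhuisGeometry.sigma L 1 0 = c) :
    (c = 0 → False) ∧
    (c ≠ 0 →
      ∃ ε : ℝ, (ε = 1 ∨ ε = -1) ∧
      ∃ φ : OpenPartialHomeomorph (NijenhuisGeometry.Coord 3) (NijenhuisGeometry.Coord 3),
        NijenhuisGeometry.IsSmoothChange φ ∧ 0 ∈ φ.source ∧ φ.source ⊆ U ∧ φ 0 = 0 ∧
        ∀ x y z : ℝ, ![x, y, z] ∈ φ.target →
          NijenhuisGeometry.matrixInCoords L φ ![x, y, z] =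
            !![-ε * x ^ 2 - c, -(x / (2 * c)), x / (2 * c ^ 2);
               -ε * (2 * x * y), -(y / c), y / c ^ 2 + 1;
               -ε * (2 * x * z), -(z / c), z / c ^ 2] ∧
          NijenhuisGeometry.charPoly L (φ.symm ![x, y, z]) =
            Polynomial.X ^ 3
              + Polynomial.C (ε * x ^ 2 + y / c - z / c ^ 2 + c) * Polynomial.X ^ 2
              + Polynomial.C y * Polynomial.X + Polynomial.C z) := by
  have hL₁ : ∀ p ∈ U, ∀ v, _ := fun p hp v => hL.fderiv_sigma_one_comp hU hp v
  have hL₂ : ∀ p ∈ U, ∀ v, _ := fun p hp v => hL.fderiv_sigma_two_comp hU hp v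
  have hL₃ : ∀ p ∈ U, ∀ v, _ := fun p hp v => hL.fderiv_sigma_three_comp hU hp v
  obtain ⟨hc0, ε, hε, φ, hφ, hφ0, hφU, hφ00, hs⟩ := NijenhuisGeometry.exists_morse_coordinates
    hU h0 (NijenhuisGeometry.contDiffOn_sigma_one hL.smooth)
    (NijenhuisGeometry.contDiffOn_sigma_two hL.smooth)
    (NijenhuisGeometry.contDiffOn_sigma_three hL.smooth) hL₁ hL₂ hL₃ hind.self_of_nhds h2 h3 hMorse
  rw [hc] at hc0 hs
  refine ⟨hc0, fun _ => ⟨ε, hε, φ, hφ, hφ0, hφU, hφ00, fun x y z hq => ⟨?_, ?_⟩⟩⟩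
  · exact NijenhuisGeometry.matrixInCoords_eq_normalForm hL.smooth hL₁ hL₂ hL₃ hc0
      (by rcases hε with rfl | rfl <;> norm_num) hφ hφU hs hq
  · obtain ⟨e2, e3, e1⟩ := hs _ (φ.map_target hq)
    rw [← e2, ← e3, φ.right_inv hq] at e1
    rw [φ.right_inv hq] at e2 e3
    rw [NijenhuisGeometry.charPoly_eq_sigma, e1, ← e2, ← e3]
    rfl
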